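/- Let $n\ge 0$, let $\Omega\subseteq\mathbb R^n$ be open, and let nets be indexed by $\varepsilon\in(0,1]$. For a locally convex space $E$ with seminorms $(p_i)_{i\in I}$ let $\mathcal M_E$ be the set of nets $(u_\varepsilon)_\varepsilon\in E^{(0,1]}$ such that for every $i$ there is $N\in\mathbb N$ with $p_i(u_\varepsilon)=O(\varepsilon^{-N})$ as $\varepsilon\to0$ ($E$-moderate nets), let $\mathcal N_E$ be the set of nets with $p_i(u_\varepsilon)=O(\varepsilon^{q})$ for all $i$ and all $q\in\mathbb N$, and put $\mathcal G_E=\mathcal M_E/\mathcal N_E$; it is topologized by the ultra-pseudo-seminorms $\mathcal P_i=e^{-v_i}$, $v_i([(u_\varepsilon)_\varepsilon])=\sup\{b\in\mathbb R: p_i(u_\varepsilon)=O(\varepsilon^b)\}$. Let $\widetilde{\mathbb C}=\mathcal G_{\mathbb C}$ be the ring of complex generalized numbers and $\mathcal G(\Omega)=\mathcal G_{C^\infty(\Omega)}$ the Colombeau algebra, a topological $\widetilde{\mathbb C}$-module, where $C^\infty(\Omega)$ carries the seminorms $p_{K,j}(f)=\sup_{x\in K,|\alpha|\le j}|\partial^\alpha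 f(x)|$, $K\Subset\Omega$, $j\in\mathbb N$. Let $\mathcal G_c(\Omega)\subseteq\mathcal G(\Omega)$ be the submodule of generalized functions with compact support, with the strict inductive limit topology (in the category of locally convex topological $\widetilde{\mathbb C}$-modules) of the submodules $\mathcal G_K(\Omega)$, $K\Subset\Omega$, of elements with support in $K$; $\mathcal G_K(\Omega)$ carries the ultra-pseudo-seminorms $\mathcal P_{K',j}$, $j\in\mathbb N$, where $K'\Subset\Omega$ is any compact set containing $K$ in its interior. Let $\mathcal G_c^0(\Omega)$ be the same module with the inductive limit topology obtained by using only $j=0$. Let $\mathcal L(\cdot,\widetilde{\mathbb C})$ denote the continuous $\widetilde{\mathbb C}$-linear functionals; $\mathcal L(\mathcal G_c^0(\Omega),\widetilde{\mathbb C})\subseteq\mathcal L(\mathcal G_c(\Omega),\widetilde{\mathbb C})$, and $\mathcal L(\mathcal G(\Omega),\widetilde{\mathbb C})$ is regarded as a subspace of $\mathcal L(\mathcal G_c(\Omega),\widetilde{\mathbb C})$ by restricting functionals to $\mathcal G_c(\Omega)$. For a $\widetilde{\mathbb C}$-linear functional $T$ on $\mathcal G_c(\Omega)$ put $(\partial^\alpha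 T)(u)=(-1)^{|\alpha|}T(\partial^\alpha u)$; the restriction of a functional on $\mathcal G_c(\mathbb R^n)$ to $\Omega$ is its composition with the extension by zero $\mathcal G_c(\Omega)\to\mathcal G_c(\mathbb R^n)$. A functional $T\in\mathcal L(\mathcal G_c(\Omega),\widetilde{\mathbb C})$ is basic if there is a net $(T_\varepsilon)_\varepsilon$ in $\mathcal D'(\Omega)$ such that for every $K\Subset\Omega$ there are $j,N\in\mathbb N$, $c>0$, $\eta\in(0,1]$ with $|T_\varepsilon(f)|\le c\,\varepsilon^{-N}p_{K,j}(f)$ for all $f\in C^\infty_c(\Omega)$ with support in $K$ and all $\varepsilon\in(0,\eta]$, and $Tu=[(T_\varepsilon u_\varepsilon)_\varepsilon]$ for all $u\in\mathcal G_c(\Omega)$, where $(u_\varepsilon)_\varepsilon$ is a representative of $u$ with supports in a fixed compact subset of $\Omega$. A functional $T\in\mathcal L(\mathcal G(\Omega),\widetilde{\mathbb C})$ is basic if there are a net $(T_\varepsilon)_\varepsilon$ in $\mathcal E'(\Omega)$ and $K\Subset\Omega$, $j,N\in\mathbb N$, $c>0$, $\eta\in(0,1]$ with $|T_\varepsilon(f)|\le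 c\,\varepsilon^{-N}p_{K,j}(f)$ for all $f\in C^\infty(\Omega)$ and all $\varepsilon\in(0,\eta]$, and $Tu=[(T_\varepsilon u_\varepsilon)_\varepsilon]$ for all $u=[(u_\varepsilon)_\varepsilon]\in\mathcal G(\Omega)$. A functional $F$ on $\mathcal G_c(\Omega)$ is defined by a net $(f_\varepsilon)_\varepsilon\in\mathcal M_{C(\Omega)}$ (with the seminorms $\sup_K|f|$, $K\Subset\Omega$, on $C(\Omega)$) if $F(u)=\bigl[\bigl(\int_\Omega f_\varepsilon u_\varepsilon\,dx\bigr)_\varepsilon\bigr]$ for all $u\in\mathcal G_c(\Omega)$, with $(u_\varepsilon)_\varepsilon$ as above. **Theorem.** (i) Let $T\in\mathcal L(\mathcal G_c(\mathbb R^n),\widetilde{\mathbb C})$ be basic and let $\Omega\subseteq\mathbb R^n$ be a bounded open set. Then there are a multi-index $\alpha\in\mathbb N^n$ and a functional $F\in\mathcal L(\mathcal G_c^0(\Omega),\widetilde{\mathbb C})$ defined by a net in $\mathcal M_{C(\Omega)}$ such that $T|_\Omega=\partial^\alpha F$. (ii) Let $T\in\mathcal L(\mathcal G(\mathbb R^n),\widetilde{\mathbb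 C})$ be basic. Then there are an integer $m\ge0$ and functionals $T_\alpha\in\mathcal L(\mathcal G_c^0(\mathbb R^n),\widetilde{\mathbb C})$, $|\alpha|\le m$, each defined by a net in $\mathcal M_{C(\mathbb R^n)}$, such that $T=\sum_{|\alpha|\le m}\partial^\alpha T_\alpha$ in $\mathcal L(\mathcal G_c(\mathbb R^n),\widetilde{\mathbb C})$. -/

import Mathlib

open Filter Asymptotics TopologicalSpace Topology
open scoped ContDiff Distributions

noncomputable section

namespace Colombeau

/-- The parameter set `(0, 1]`. -/
abbrev Eps : Type := Set.Ioc (0 : ℝ) 1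

/-- The filter `ε → 0` on `(0, 1]`. -/
def epsZero : Filter Eps := comap Subtype.val (𝓝 0)

/-- `a_ε = O(ε ^ b)` as `ε → 0`. -/
def IsOrd (a : Eps → ℝ) (b : ℝ) : Prop := a =O[epsZero] fun ε => (ε : ℝ) ^ b

lemma IsOrd.mono {a : Eps → ℝ} {b c : ℝ} (h : IsOrd a b) (hcb : c ≤ b) : IsOrd a c := by
  refine h.trans (IsBigO.of_bound 1 (Eventually.of_forall fun ε => ?_))
  have h0 : (0 : ℝ) < ε := ε.2.1
  rw [one_mul, Real.norm_of_nonneg (by positivity), Real.norm_of_nonneg (by positivity)]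
  exact Real.rpow_le_rpow_of_exponent_ge h0 ε.2.2 hcb

lemma IsOrd.of_le {a a' : Eps → ℝ} {b : ℝ} (h : IsOrd a b) {C : ℝ}
    (ha : ∀ ε, |a' ε| ≤ C * |a ε|) : IsOrd a' b :=
  (IsBigO.of_bound C (Eventually.of_forall ha)).trans h

lemma IsOrd.add {a a' : Eps → ℝ} {b : ℝ} (h : IsOrd a b) (h' : IsOrd a' b) :
    IsOrd (fun ε => a ε + a' ε) b := IsBigO.add h h'

lemma IsOrd.mul {a a' : Eps → ℝ} {b b' : ℝ} (h : IsOrd a b) (h' : IsOrd a' b') :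
    IsOrd (fun ε => a ε * a' ε) (b + b') := by
  have := IsBigO.mul h h'
  refine this.congr_right fun ε => ?_
  rw [Real.rpow_add ε.2.1]

lemma isOrd_zero (b : ℝ) : IsOrd (fun _ => 0) b := isBigO_zero _ _

section Model

variable {E F ι κ : Type*} [AddCommGroup E] [Module ℂ E] [AddCommGroup F] [Module ℂ F]

/-- Moderate nets in a space topologized by the seminorms `p i`. -/
def IsModerate (p : ι → Seminorm ℂ E) (u : Eps → E) : Prop :=
  ∀ i, ∃ N : ℕ, IsOrd (fun ε => p i (u ε)) (-(N : ℝ))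

/-- Negligible nets in a space topologized by the seminorms `p i`. -/
def IsNegligible (p : ι → Seminorm ℂ E) (u : Eps → E) : Prop :=
  ∀ i, ∀ q : ℕ, IsOrd (fun ε => p i (u ε)) (q : ℝ)

/-- The absolute value of `ℂ`, as a one-element family of seminorms. -/
def absFamily : Unit → Seminorm ℂ ℂ := fun _ => normSeminorm ℂ ℂ

lemma isModerate_num {z : Eps → ℂ} :
    IsModerate absFamily z ↔ ∃ N : ℕ, IsOrd (fun ε => ‖z ε‖) (-(N : ℝ)) :=
  ⟨fun h => h (), fun h _ => h⟩

lemma isNegligible_num {z : Eps → ℂ} :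
    IsNegligible absFamily z ↔ ∀ q : ℕ, IsOrd (fun ε => ‖z ε‖) (q : ℝ) :=
  ⟨fun h => h (), fun h _ => h⟩

lemma isOrd_seminorm_add {p : Seminorm ℂ E} {u v : Eps → E} {b : ℝ}
    (hu : IsOrd (fun ε => p (u ε)) b) (hv : IsOrd (fun ε => p (v ε)) b) :
    IsOrd (fun ε => p (u ε + v ε)) b := by
  refine (hu.add hv).of_le (C := 1) fun ε => ?_
  rw [abs_of_nonneg (apply_nonneg _ _), one_mul,
    abs_of_nonneg (add_nonneg (apply_nonneg _ _) (apply_nonneg _ _))]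
  exact map_add_le_add p _ _

lemma IsModerate.add {p : ι → Seminorm ℂ E} {u v : Eps → E} (hu : IsModerate p u)
    (hv : IsModerate p v) : IsModerate p (u + v) := fun i => by
  obtain ⟨N, hN⟩ := hu i
  obtain ⟨M, hM⟩ := hv i
  refine ⟨max N M, isOrd_seminorm_add (hN.mono ?_) (hM.mono ?_)⟩ <;> simp

lemma IsNegligible.add {p : ι → Seminorm ℂ E} {u v : Eps → E} (hu : IsNegligible p u)
    (hv : IsNegligible p v) : IsNegligible p (u + v) :=
  fun i q => isOrd_seminorm_add (hu i q) (hv i q)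

lemma isModerate_zero (p : ι → Seminorm ℂ E) : IsModerate p 0 :=
  fun i => ⟨0, by simpa using isOrd_zero _⟩

lemma isNegligible_zero (p : ι → Seminorm ℂ E) : IsNegligible p 0 :=
  fun i q => by simpa using isOrd_zero _

lemma IsModerate.smul {p : ι → Seminorm ℂ E} {z : Eps → ℂ} {u : Eps → E}
    (hz : IsModerate absFamily z) (hu : IsModerate p u) : IsModerate p (z • u) := fun i => by
  obtain ⟨N, hN⟩ := hu i
  obtain ⟨M, hM⟩ := isModerate_num.1 hz
  refine ⟨M + N, ?_⟩
  convert hM.mul hN using 1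
  · ext ε
    simp [map_smul_eq_mul]
  · push_cast
    ring

lemma IsNegligible.smul {p : ι → Seminorm ℂ E} {z : Eps → ℂ} {u : Eps → E}
    (hz : IsModerate absFamily z) (hu : IsNegligible p u) : IsNegligible p (z • u) := fun i q => by
  obtain ⟨M, hM⟩ := isModerate_num.1 hz
  convert hM.mul (hu i (M + q)) using 1
  · ext ε
    simp [map_smul_eq_mul]
  · push_cast
    ring

lemma IsNegligible.smul' {p : ι → Seminorm ℂ E} {z : Eps → ℂ} {u : Eps → E}
    (hz : IsNegligible absFamily z) (hu : IsModerate p u) : IsNegligible p (z • u) := fun i q => by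
  obtain ⟨M, hM⟩ := hu i
  convert (isNegligible_num.1 hz (M + q)).mul hM using 1
  · ext ε
    simp [map_smul_eq_mul]
  · push_cast
    ring

lemma IsNegligible.isModerate {p : ι → Seminorm ℂ E} {u : Eps → E} (hu : IsNegligible p u) :
    IsModerate p u := fun i => ⟨0, by simpa using hu i 0⟩

/-- The ring of moderate nets of complex numbers. -/
def modNum : Subring (Eps → ℂ) where
  carrier := {z | IsModerate absFamily z}
  mul_mem' := fun ha hb => IsModerate.smul (p := absFamily) ha hb
  one_mem' := isModerate_num.2 ⟨0, by
    simpa [IsOrd] using (isBigO_refl (fun _ : Eps => (1 : ℝ)) epsZero)⟩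
  add_mem' := fun ha hb => ha.add hb
  zero_mem' := isModerate_zero _
  neg_mem' := by
    intro x hx i
    simpa using hx i

/-- The ideal of negligible nets of complex numbers. -/
def negNum : Ideal modNum where
  carrier := {z | IsNegligible absFamily (z : Eps → ℂ)}
  add_mem' := fun ha hb => ha.add hb
  zero_mem' := isNegligible_zero _
  smul_mem' := fun c _ hx => IsNegligible.smul (p := absFamily) c.2 hx

/-- The ring of complex generalized numbers. -/
def CTilde : Type := modNum ⧸ negNum

instance : CommRing CTilde := inferInstanceAs (CommRing (modNum ⧸ negNum))

/-- The class of a moderate net of complex numbers. -/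
def CTilde.mk (z : Eps → ℂ) (hz : IsModerate absFamily z) : CTilde :=
  Ideal.Quotient.mk negNum ⟨z, hz⟩

/-- The net `z` of complex numbers is moderate and its class is `x`, that is `x = [(z_ε)_ε]`. -/
def Represents (x : CTilde) (z : Eps → ℂ) : Prop :=
  ∃ hz : IsModerate absFamily z, CTilde.mk z hz = x

/-- The moderate nets in a space with seminorms `p`. -/
def modNets (p : ι → Seminorm ℂ E) : Submodule modNum (Eps → E) where
  carrier := {u | IsModerate p u}
  add_mem' := fun ha hb => ha.add hb
  zero_mem' := isModerate_zero _
  smul_mem' := fun c _ hx => IsModerate.smul c.2 hx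

/-- The negligible nets, as a submodule of the moderate ones. -/
def negNets (p : ι → Seminorm ℂ E) : Submodule modNum (modNets p) where
  carrier := {u | IsNegligible p (u : Eps → E)}
  add_mem' := fun ha hb => ha.add hb
  zero_mem' := isNegligible_zero _
  smul_mem' := fun c _ hx => IsNegligible.smul c.2 hx

/-- The space of generalized functions based on `E`: moderate nets modulo negligible nets. -/
def GE (p : ι → Seminorm ℂ E) : Type _ := modNets p ⧸ negNets p

instance (p : ι → Seminorm ℂ E) : AddCommGroup (GE p) :=
  inferInstanceAs (AddCommGroup (modNets p ⧸ negNets p))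

lemma torsion_GE (p : ι → Seminorm ℂ E) :
    Module.IsTorsionBySet modNum (modNets p ⧸ negNets p) (negNum : Set modNum) := by
  rintro x ⟨z, hz⟩
  obtain ⟨u, rfl⟩ := (negNets p).mkQ_surjective x
  change (Submodule.Quotient.mk (z • u) : modNets p ⧸ negNets p) = 0
  rw [Submodule.Quotient.mk_eq_zero]
  exact IsNegligible.smul' hz u.2

instance (p : ι → Seminorm ℂ E) : Module CTilde (GE p) :=
  (torsion_GE p).module

/-- The class of a moderate net. -/
def GE.mk {p : ι → Seminorm ℂ E} (u : Eps → E) (hu : IsModerate p u) : GE p :=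
  Submodule.Quotient.mk (⟨u, hu⟩ : modNets p)

lemma GE.ind {p : ι → Seminorm ℂ E} (x : GE p) : ∃ u, ∃ hu : IsModerate p u, GE.mk u hu = x := by
  obtain ⟨u, rfl⟩ := (negNets p).mkQ_surjective x
  exact ⟨u.1, u.2, rfl⟩

lemma CTilde.ind (x : CTilde) : ∃ z, ∃ hz : IsModerate absFamily z, CTilde.mk z hz = x := by
  obtain ⟨u, rfl⟩ := Ideal.Quotient.mk_surjective x
  exact ⟨u.1, u.2, rfl⟩

lemma GE.mk_eq_mk {p : ι → Seminorm ℂ E} {u v : Eps → E} {hu : IsModerate p u}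
    {hv : IsModerate p v} : GE.mk u hu = GE.mk v hv ↔ IsNegligible p (u - v) :=
  Submodule.Quotient.eq _

lemma GE.mk_eq_zero {p : ι → Seminorm ℂ E} {u : Eps → E} {hu : IsModerate p u} :
    GE.mk u hu = 0 ↔ IsNegligible p u :=
  Submodule.Quotient.mk_eq_zero _

lemma GE.mk_add {p : ι → Seminorm ℂ E} {u v : Eps → E} {hu : IsModerate p u}
    {hv : IsModerate p v} : GE.mk (u + v) (hu.add hv) = GE.mk u hu + GE.mk v hv := rfl

lemma GE.mk_smul {p : ι → Seminorm ℂ E} {z : Eps → ℂ} {u : Eps → E}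
    {hz : IsModerate absFamily z} {hu : IsModerate p u} :
    GE.mk (z • u) (hz.smul hu) = CTilde.mk z hz • GE.mk u hu := rfl

/-- The map induced on generalized functions by a linear map bounded for the seminorms. -/
def GE.map {p : ι → Seminorm ℂ E} {q : κ → Seminorm ℂ F} (A : E →ₗ[ℂ] F)
    (hA : ∀ j, ∃ i, ∀ f, q j (A f) ≤ p i f) : GE p →ₗ[CTilde] GE q where
  toFun := Quotient.lift
    (fun u : modNets p => GE.mk (p := q) (fun ε => A (u.1 ε)) (fun j => by
      obtain ⟨i, hi⟩ := hA j
      obtain ⟨N, hN⟩ := u.2 i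
      refine ⟨N, hN.of_le (C := 1) fun ε => ?_⟩
      rw [abs_of_nonneg (apply_nonneg _ _), abs_of_nonneg (apply_nonneg _ _), one_mul]
      exact hi _))
    (by
      intro u v huv
      have huv' : IsNegligible p (u.1 - v.1) := (Submodule.quotientRel_def _).1 huv
      refine GE.mk_eq_mk.2 fun j r => ?_
      obtain ⟨i, hi⟩ := hA j
      refine (huv' i r).of_le (C := 1) fun ε => ?_
      rw [abs_of_nonneg (apply_nonneg _ _), abs_of_nonneg (apply_nonneg _ _), one_mul]
      simpa using hi (u.1 ε - v.1 ε))
  map_add' := by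
    intro x y
    obtain ⟨u, hu, rfl⟩ := GE.ind x
    obtain ⟨v, hv, rfl⟩ := GE.ind y
    refine GE.mk_eq_mk.2 ?_
    convert isNegligible_zero q
    ext ε
    simp
  map_smul' := by
    intro c x
    obtain ⟨u, hu, rfl⟩ := GE.ind x
    obtain ⟨z, hz, rfl⟩ := CTilde.ind c
    refine GE.mk_eq_mk.2 ?_
    convert isNegligible_zero q
    ext ε
    simp only [Pi.sub_apply, Pi.zero_apply, sub_eq_zero]
    exact A.map_smul _ _

lemma isModerate_map {p : ι → Seminorm ℂ E} {q : κ → Seminorm ℂ F} {A : E →ₗ[ℂ] F}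
    (hA : ∀ j, ∃ i, ∀ f, q j (A f) ≤ p i f) {u : Eps → E} (hu : IsModerate p u) :
    IsModerate q (fun ε => A (u ε)) := fun j => by
  obtain ⟨i, hi⟩ := hA j
  obtain ⟨N, hN⟩ := hu i
  refine ⟨N, hN.of_le (C := 1) fun ε => ?_⟩
  rw [abs_of_nonneg (apply_nonneg _ _), abs_of_nonneg (apply_nonneg _ _), one_mul]
  exact hi _

lemma GE.map_mk {p : ι → Seminorm ℂ E} {q : κ → Seminorm ℂ F} {A : E →ₗ[ℂ] F}
    (hA : ∀ j, ∃ i, ∀ f, q j (A f) ≤ p i f) {u : Eps → E} (hu : IsModerate p u) :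
    GE.map A hA (GE.mk u hu) = GE.mk (fun ε => A (u ε)) (isModerate_map hA hu) := rfl

/-- The valuation `sup {b : a_ε = O(ε ^ b)}` of a net of real numbers. -/
def netVal (a : Eps → ℝ) : EReal := ⨆ (b : ℝ) (_ : IsOrd a b), (b : EReal)

lemma isOrd_seminorm_congr {p : Seminorm ℂ E} {u v : Eps → E}
    (h : ∀ q : ℕ, IsOrd (fun ε => p (u ε - v ε)) q) {b : ℝ} (hu : IsOrd (fun ε => p (u ε)) b) :
    IsOrd (fun ε => p (v ε)) b := by
  obtain ⟨q, hq⟩ := exists_nat_ge b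
  refine (hu.add ((h q).mono hq)).of_le (C := 1) fun ε => ?_
  rw [abs_of_nonneg (apply_nonneg _ _), one_mul,
    abs_of_nonneg (add_nonneg (apply_nonneg _ _) (apply_nonneg _ _))]
  have := map_sub_le_add p (u ε) (u ε - v ε)
  simpa using this

lemma netVal_congr {p : Seminorm ℂ E} {u v : Eps → E}
    (h : ∀ q : ℕ, IsOrd (fun ε => p (u ε - v ε)) q) :
    netVal (fun ε => p (u ε)) = netVal (fun ε => p (v ε)) := by
  have h' : ∀ q : ℕ, IsOrd (fun ε => p (v ε - u ε)) q := fun q => by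
    simpa only [map_sub_rev] using h q
  have : ∀ b, IsOrd (fun ε => p (u ε)) b ↔ IsOrd (fun ε => p (v ε)) b :=
    fun b => ⟨isOrd_seminorm_congr h, isOrd_seminorm_congr h'⟩
  simp only [netVal, this]

/-- The valuation on generalized functions given by the seminorm `p i`. -/
def GE.val {p : ι → Seminorm ℂ E} (i : ι) : GE p → EReal :=
  Quotient.lift (fun u : modNets p => netVal fun ε => p i (u.1 ε)) (by
    intro u v huv
    have huv' : IsNegligible p (u.1 - v.1) := (Submodule.quotientRel_def _).1 huv
    exact netVal_congr (huv' i))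

/-- The ultra-pseudo-seminorm `exp (-val)` given by the seminorm `p i`. -/
def GE.ups {p : ι → Seminorm ℂ E} (i : ι) (x : GE p) : ENNReal := EReal.exp (-(GE.val i x))

/-- The valuation on generalized numbers. -/
def CTilde.val : CTilde → EReal :=
  Quotient.lift (fun z : modNum => netVal fun ε => ‖z.1 ε‖) (by
    intro u v huv
    have huv' : IsNegligible absFamily (u.1 - v.1) := (Submodule.quotientRel_def _).1 huv
    exact netVal_congr (p := normSeminorm ℂ ℂ) (huv' ()))

/-- The ultra-pseudo-norm on generalized numbers. -/
def CTilde.enorm (x : CTilde) : ENNReal := EReal.exp (-(CTilde.val x))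

/-- The topology given by a family of ultra-pseudo-seminorms: generated by all the balls. -/
abbrev upsTopology {G : Type*} [AddCommGroup G] (P : ι → G → ENNReal) : TopologicalSpace G :=
  TopologicalSpace.generateFrom {s | ∃ i x r, 0 < r ∧ s = {y | P i (y - x) < r}}

instance : TopologicalSpace CTilde := upsTopology fun _ : Unit => CTilde.enorm

instance (p : ι → Seminorm ℂ E) : TopologicalSpace (GE p) := upsTopology fun i => GE.ups i

end Model

section Limit

variable {G : Type*} [AddCommGroup G] [Module CTilde G]

/-- `A` is absolutely convex: closed under addition and under multiplication by the generalized
numbers of ultra-pseudo-norm at most one. -/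
def AbsConvex (A : Set G) : Prop :=
  (∀ x ∈ A, ∀ y ∈ A, x + y ∈ A) ∧ ∀ c : CTilde, c.enorm ≤ 1 → ∀ x ∈ A, c • x ∈ A

/-- `τ` makes `G` a locally convex topological module over the ring of generalized numbers. -/
structure IsLocallyConvex (τ : TopologicalSpace G) : Prop where
  addGroup : @IsTopologicalAddGroup G τ _
  smul : @ContinuousSMul CTilde G _ _ τ
  base : ∀ U ∈ @nhds G τ 0, ∃ A ∈ @nhds G τ 0, A ⊆ U ∧ AbsConvex A

/-- The inductive limit topology for submodules `S k` with topologies `t k`: the finest locally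
convex module topology for which all the inclusions are continuous. -/
abbrev limTopology {κ : Type*} (S : κ → Submodule CTilde G) (t : ∀ k, TopologicalSpace (S k)) :
    TopologicalSpace G :=
  sInf {τ | IsLocallyConvex τ ∧ ∀ k, @Continuous (S k) G (t k) τ Subtype.val}

end Limit

section Smooth

variable {n : ℕ}

/-- Euclidean `n`-space. -/
abbrev Rn (n : ℕ) : Type := EuclideanSpace ℝ (Fin n)

/-- The smooth functions on `Ω`, as a space of functions on the whole space that are extended by
the value zero outside `Ω`. -/
def smoothSub (Ω : Opens (Rn n)) : Submodule ℂ (Rn n → ℂ) where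
  carrier := {f | ContDiffOn ℝ ∞ f Ω ∧ ∀ x ∉ Ω, f x = 0}
  add_mem' := fun hf hg => ⟨hf.1.add hg.1, fun x hx => by simp [hf.2 x hx, hg.2 x hx]⟩
  zero_mem' := ⟨contDiffOn_const, fun _ _ => rfl⟩
  smul_mem' := fun c _ hf => ⟨hf.1.const_smul c, fun x hx => by simp [hf.2 x hx]⟩

/-- The space of complex-valued smooth functions on `Ω`. -/
def Smooth (Ω : Opens (Rn n)) : Type := smoothSub Ω

instance (Ω : Opens (Rn n)) : AddCommGroup (Smooth Ω) := inferInstanceAs (AddCommGroup (smoothSub Ω))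

instance (Ω : Opens (Rn n)) : Module ℂ (Smooth Ω) := inferInstanceAs (Module ℂ (smoothSub Ω))

instance (Ω : Opens (Rn n)) : CoeFun (Smooth Ω) fun _ => Rn n → ℂ := ⟨Subtype.val⟩

variable {Ω V : Opens (Rn n)}

lemma Smooth.ext {f g : Smooth Ω} (h : ∀ x ∈ Ω, f x = g x) : f = g := by
  refine Subtype.ext (funext fun x => ?_)
  by_cases hx : x ∈ Ω
  · exact h x hx
  · exact (f.2.2 x hx).trans (g.2.2 x hx).symm

lemma Smooth.add_apply (f g : Smooth Ω) (x : Rn n) : (f + g) x = f x + g x := rfl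

lemma Smooth.smul_apply (c : ℂ) (f : Smooth Ω) (x : Rn n) : (c • f) x = c * f x := rfl

lemma Smooth.contDiffAt (f : Smooth Ω) {x : Rn n} (hx : x ∈ Ω) : ContDiffAt ℝ ∞ f x :=
  f.2.1.contDiffAt (Ω.isOpen.mem_nhds hx)

lemma Smooth.differentiableAt (f : Smooth Ω) {x : Rn n} (hx : x ∈ Ω) : DifferentiableAt ℝ f x :=
  (f.contDiffAt hx).differentiableAt (by simp)

/-- The smooth function on `Ω` given by `f` on `Ω`. -/
def Smooth.of (f : Rn n → ℂ) (hf : ContDiffOn ℝ ∞ f Ω) : Smooth Ω :=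
  ⟨(Ω : Set (Rn n)).indicator f,
    hf.congr fun _ hx => Set.indicator_of_mem hx f, fun _ hx => Set.indicator_of_notMem hx f⟩

lemma Smooth.of_apply {f : Rn n → ℂ} (hf : ContDiffOn ℝ ∞ f Ω) {x : Rn n} (hx : x ∈ Ω) :
    Smooth.of f hf x = f x := Set.indicator_of_mem hx f

lemma Smooth.of_eventuallyEq {f : Rn n → ℂ} (hf : ContDiffOn ℝ ∞ f Ω) {x : Rn n} (hx : x ∈ Ω) :
    (Smooth.of f hf : Rn n → ℂ) =ᶠ[𝓝 x] f :=
  (Ω.isOpen.eventually_mem hx).mono fun _ hy => Smooth.of_apply hf hy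

lemma contDiffOn_pd (f : Smooth Ω) (v : Rn n) :
    ContDiffOn ℝ ∞ (fun x => fderiv ℝ f x v) Ω := by
  refine ContDiffOn.clm_apply ?_ contDiffOn_const
  exact f.2.1.fderiv_of_isOpen Ω.isOpen (by simp)

/-- The partial derivative `∂_i` on smooth functions. -/
def pd (i : Fin n) : Smooth Ω →ₗ[ℂ] Smooth Ω where
  toFun f := Smooth.of (fun x => fderiv ℝ f x (EuclideanSpace.single i 1)) (contDiffOn_pd f _)
  map_add' f g := Smooth.ext fun x hx => by
    rw [Smooth.add_apply, Smooth.of_apply _ hx, Smooth.of_apply _ hx, Smooth.of_apply _ hx]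
    have : fderiv ℝ (f + g : Smooth Ω) x = fderiv ℝ f x + fderiv ℝ g x :=
      fderiv_add (f.differentiableAt hx) (g.differentiableAt hx)
    rw [this]
    rfl
  map_smul' c f := Smooth.ext fun x hx => by
    rw [RingHom.id_apply, Smooth.smul_apply, Smooth.of_apply _ hx, Smooth.of_apply _ hx]
    have : fderiv ℝ (c • f : Smooth Ω) x = c • fderiv ℝ f x :=
      fderiv_const_smul (f.differentiableAt hx) c
    rw [this]
    rfl

lemma pd_apply (i : Fin n) (f : Smooth Ω) {x : Rn n} (hx : x ∈ Ω) :
    pd i f x = fderiv ℝ f x (EuclideanSpace.single i 1) :=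
  Smooth.of_apply (contDiffOn_pd f _) hx

lemma pd_comm (i j : Fin n) : Commute (pd i : Module.End ℂ (Smooth Ω)) (pd j) := by
  have key : ∀ (f : Smooth Ω) (i j : Fin n) (x : Rn n), x ∈ Ω → pd i (pd j f) x =
      fderiv ℝ (fderiv ℝ f) x (EuclideanSpace.single i 1) (EuclideanSpace.single j 1) := by
    intro f i j x hx
    rw [pd_apply _ _ hx]
    have h1 : (pd j f : Rn n → ℂ) =ᶠ[𝓝 x] fun y => fderiv ℝ f y (EuclideanSpace.single j 1) :=
      Smooth.of_eventuallyEq (contDiffOn_pd f _) hx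
    have h2 : DifferentiableAt ℝ (fderiv ℝ f) x :=
      ((f.contDiffAt hx).fderiv_right (m := 1)
        (WithTop.coe_le_coe.2 le_top : ((2 : ℕ∞) : WithTop ℕ∞) ≤ ∞)).differentiableAt (by simp)
    rw [h1.fderiv_eq, fderiv_clm_apply h2 (differentiableAt_const _)]
    simp
  refine LinearMap.ext fun f => Smooth.ext fun x hx => ?_
  change pd i (pd j f) x = pd j (pd i f) x
  rw [key f i j x hx, key f j i x hx]
  exact (f.contDiffAt hx).isSymmSndFDerivAt (by simpa using (WithTop.coe_le_coe.2 le_top : ((2 : ℕ∞) : WithTop ℕ∞) ≤ ∞)) _ _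

/-- The derivative `∂^α` of a multi-index `α` on smooth functions. -/
def der (α : Fin n → ℕ) : Module.End ℂ (Smooth Ω) :=
  ((List.finRange n).map fun i => pd i ^ α i).prod

lemma der_zero : (der 0 : Module.End ℂ (Smooth Ω)) = 1 := by
  simp [der]

lemma der_add_single (α : Fin n → ℕ) (i : Fin n) :
    (der (α + Pi.single i 1) : Module.End ℂ (Smooth Ω)) = der α * pd i := by
  have key : ∀ l : List (Fin n), l.Nodup →
      (l.map fun j => (pd j : Module.End ℂ (Smooth Ω)) ^ (α + Pi.single i 1 : Fin n → ℕ) j).prod =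
      (l.map fun j => (pd j : Module.End ℂ (Smooth Ω)) ^ α j).prod * if i ∈ l then pd i else 1 := by
    intro l
    induction l with
    | nil => simp
    | cons a l ih =>
      intro hl
      rw [List.nodup_cons] at hl
      rw [List.map_cons, List.map_cons, List.prod_cons, List.prod_cons, ih hl.2]
      by_cases h : a = i
      · subst h
        simp only [hl.1, List.mem_cons, true_or, if_true, if_false, mul_one, Pi.add_apply,
          Pi.single_eq_same, pow_succ]
        rw [mul_assoc, mul_assoc]
        congr 1
        exact (Commute.list_prod_right _ _ fun x hx => by
          obtain ⟨j, -, rfl⟩ := List.mem_map.1 hx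
          exact (pd_comm a j).pow_right _).eq
      · have h' : i ≠ a := fun h' => h h'.symm
        simp [h, h', mul_assoc]
  simpa [der] using key (List.finRange n) (List.nodup_finRange n)

/-- The multi-indices of order at most `m`. -/
def multiIdx (n m : ℕ) : Finset (Fin n → ℕ) :=
  (Finset.Iic fun _ => m).filter fun α => ∑ i, α i ≤ m

lemma mem_multiIdx {m : ℕ} {α : Fin n → ℕ} : α ∈ multiIdx n m ↔ ∑ i, α i ≤ m := by
  simp only [multiIdx, Finset.mem_filter, Finset.mem_Iic, and_iff_right_iff_imp]
  exact fun h i => (Finset.single_le_sum (fun _ _ => Nat.zero_le _) (Finset.mem_univ i)).trans h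

/-- The compact subsets of `Ω`. -/
abbrev CptIn (Ω : Opens (Rn n)) : Type := {K : Set (Rn n) // IsCompact K ∧ K ⊆ Ω}

instance : Nonempty (CptIn Ω) := ⟨⟨∅, isCompact_empty, Set.empty_subset _⟩⟩

lemma Smooth.bdd (K : CptIn Ω) (f : Smooth Ω) :
    BddAbove (Set.range fun x : K.1 => ‖f x‖) := by
  have := K.2.1.bddAbove_image (f := fun x => ‖f x‖) (f.2.1.continuousOn.mono K.2.2).norm
  rwa [Set.image_eq_range] at this

lemma Smooth.sup_le_iff (K : CptIn Ω) (f : Smooth Ω) {c : ℝ} (hc : 0 ≤ c) :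
    ⨆ x : K.1, ‖f x‖ ≤ c ↔ ∀ x ∈ K.1, ‖f x‖ ≤ c :=
  ⟨fun h x hx => (le_ciSup (f.bdd K) ⟨x, hx⟩).trans h, fun h => Real.iSup_le (fun x => h x x.2) hc⟩

/-- The seminorm `sup_{x ∈ K} |f x|`. -/
def supSemi (K : CptIn Ω) : Seminorm ℂ (Smooth Ω) :=
  Seminorm.ofSMulLE (fun f => ⨆ x : K.1, ‖f x‖)
    (le_antisymm ((Smooth.sup_le_iff K 0 le_rfl).2 fun x _ => (norm_zero (E := ℂ)).le)
      (Real.iSup_nonneg fun _ => norm_nonneg _))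
    (fun f g => by
      have h0 : ∀ f : Smooth Ω, 0 ≤ ⨆ x : K.1, ‖f x‖ := fun f =>
        Real.iSup_nonneg fun _ => norm_nonneg _
      refine (Smooth.sup_le_iff K _ (add_nonneg (h0 f) (h0 g))).2 fun x hx => ?_
      exact (norm_add_le _ _).trans
        (add_le_add (le_ciSup (f.bdd K) ⟨x, hx⟩) (le_ciSup (g.bdd K) ⟨x, hx⟩)))
    (fun c f => by
      have h0 : 0 ≤ ⨆ x : K.1, ‖f x‖ := Real.iSup_nonneg fun _ => norm_nonneg _
      refine (Smooth.sup_le_iff K _ (mul_nonneg (norm_nonneg c) h0)).2 fun x hx => ?_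
      rw [Smooth.smul_apply, norm_mul]
      exact mul_le_mul_of_nonneg_left (le_ciSup (f.bdd K) ⟨x, hx⟩) (norm_nonneg _))

/-- The seminorms `sup_{x ∈ K, |α| ≤ j} |∂^α f x|`, indexed by the pairs `(K, j)`. -/
def psemi (Ω : Opens (Rn n)) : SeminormFamily ℂ (Smooth Ω) (CptIn Ω × ℕ) :=
  fun k => (multiIdx n k.2).sup fun α => (supSemi k.1).comp (der α)

lemma psemi_le_iff (K : CptIn Ω) (j : ℕ) (f : Smooth Ω) {c : ℝ} (hc : 0 ≤ c) :
    psemi Ω (K, j) f ≤ c ↔ ∀ α : Fin n → ℕ, ∑ i, α i ≤ j → ∀ x ∈ K.1, ‖der α f x‖ ≤ c := by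
  constructor
  · intro h α hα
    refine (Smooth.sup_le_iff K (der α f) hc).1 (le_trans ?_ h)
    exact Seminorm.le_finset_sup_apply (p := fun α => (supSemi K).comp (der α))
      (mem_multiIdx.2 hα)
  · intro h
    refine Seminorm.finset_sup_apply_le hc fun α hα => ?_
    exact (Smooth.sup_le_iff K (der α f) hc).2 (h α (mem_multiIdx.1 hα))

lemma le_psemi (K : CptIn Ω) {j : ℕ} (f : Smooth Ω) {α : Fin n → ℕ} (hα : ∑ i, α i ≤ j)
    {x : Rn n} (hx : x ∈ K.1) : ‖der α f x‖ ≤ psemi Ω (K, j) f :=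
  (psemi_le_iff K j f (apply_nonneg _ _)).1 le_rfl α hα x hx

/-- The usual Fréchet topology of the space of smooth functions. -/
instance : TopologicalSpace (Smooth Ω) := (psemi Ω).moduleFilterBasis.topology

lemma psemi_pd_le (K : CptIn Ω) (j : ℕ) (i : Fin n) (f : Smooth Ω) :
    psemi Ω (K, j) (pd i f) ≤ psemi Ω (K, j + 1) f := by
  refine (psemi_le_iff _ _ _ (apply_nonneg _ _)).2 fun α hα x hx => ?_
  have : der α (pd i f) = der (α + Pi.single i 1) f := by rw [der_add_single]; rfl
  rw [this]
  exact le_psemi _ _ (by simp [Finset.sum_add_distrib, hα]) hx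

lemma psemi_succ_le (K : CptIn Ω) (j : ℕ) (f : Smooth Ω) {c : ℝ} (hc : 0 ≤ c)
    (h0 : psemi Ω (K, 0) f ≤ c) (h : ∀ i, psemi Ω (K, j) (pd i f) ≤ c) :
    psemi Ω (K, j + 1) f ≤ c := by
  refine (psemi_le_iff _ _ _ hc).2 fun α hα x hx => ?_
  by_cases h00 : α = 0
  · exact (le_psemi K f (by simp [h00]) hx).trans h0
  · obtain ⟨i, hi⟩ : ∃ i, α i ≠ 0 := by
      by_contra hcon
      push Not at hcon
      exact h00 (funext hcon)
    obtain ⟨β, rfl⟩ : ∃ β : Fin n → ℕ, α = β + Pi.single i 1 := by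
      refine ⟨α - Pi.single i 1, funext fun k => ?_⟩
      by_cases hk : k = i
      · subst hk
        simp only [Pi.add_apply, Pi.sub_apply, Pi.single_eq_same]
        omega
      · simp [hk]
    rw [der_add_single]
    refine (le_psemi K (pd i f) (j := j) ?_ hx).trans (h i)
    simpa [Finset.sum_add_distrib] using hα

lemma psemi_der_le (K : CptIn Ω) (α : Fin n → ℕ) :
    ∃ m : ℕ, ∀ j, ∀ f : Smooth Ω, psemi Ω (K, j) (der α f) ≤ psemi Ω (K, j + m) f := by
  have hpow : ∀ (i : Fin n) (k : ℕ), ∃ m : ℕ, ∀ j, ∀ f : Smooth Ω,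
      psemi Ω (K, j) ((pd i ^ k : Module.End ℂ (Smooth Ω)) f) ≤ psemi Ω (K, j + m) f := by
    intro i k
    induction k with
    | zero => exact ⟨0, fun j f => by simp⟩
    | succ k ih =>
      obtain ⟨m, hm⟩ := ih
      refine ⟨m + 1, fun j f => ?_⟩
      rw [pow_succ, Module.End.mul_apply]
      exact (hm j _).trans (by simpa [add_assoc] using psemi_pd_le K (j + m) i f)
  have key : ∀ l : List (Fin n), ∃ m : ℕ, ∀ j, ∀ f : Smooth Ω,
      psemi Ω (K, j) ((l.map fun i => (pd i : Module.End ℂ (Smooth Ω)) ^ α i).prod f) ≤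
        psemi Ω (K, j + m) f := by
    intro l
    induction l with
    | nil => exact ⟨0, fun j f => by simp⟩
    | cons a l ih =>
      obtain ⟨m, hm⟩ := ih
      obtain ⟨m', hm'⟩ := hpow a (α a)
      refine ⟨m' + m, fun j f => ?_⟩
      rw [List.map_cons, List.prod_cons, Module.End.mul_apply]
      exact (hm' j _).trans (by simpa [add_assoc] using hm (j + m') f)
  exact key _

/-- Restriction of smooth functions to a smaller open set. -/
def res (h : V ≤ Ω) : Smooth Ω →ₗ[ℂ] Smooth V where
  toFun f := Smooth.of f (f.2.1.mono h)
  map_add' f g := Smooth.ext fun x hx => by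
    rw [Smooth.add_apply, Smooth.of_apply _ hx, Smooth.of_apply _ hx, Smooth.of_apply _ hx,
      Smooth.add_apply]
  map_smul' c f := Smooth.ext fun x hx => by
    rw [RingHom.id_apply, Smooth.smul_apply, Smooth.of_apply _ hx, Smooth.of_apply _ hx,
      Smooth.smul_apply]

lemma res_apply (h : V ≤ Ω) (f : Smooth Ω) {x : Rn n} (hx : x ∈ V) : res h f x = f x :=
  Smooth.of_apply (f.2.1.mono h) hx

lemma pd_res (h : V ≤ Ω) (i : Fin n) (f : Smooth Ω) : pd i (res h f) = res h (pd i f) :=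
  Smooth.ext fun x hx => by
    rw [pd_apply _ _ hx, res_apply h _ hx, pd_apply _ _ (h hx)]
    have : (res h f : Rn n → ℂ) =ᶠ[𝓝 x] f := Smooth.of_eventuallyEq (f.2.1.mono h) hx
    rw [this.fderiv_eq]

lemma der_res (h : V ≤ Ω) (α : Fin n → ℕ) (f : Smooth Ω) : der α (res h f) = res h (der α f) := by
  have hpow : ∀ (i : Fin n) (k : ℕ) (f : Smooth Ω),
      (pd i ^ k : Module.End ℂ (Smooth V)) (res h f) =
        res h ((pd i ^ k : Module.End ℂ (Smooth Ω)) f) := by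
    intro i k
    induction k with
    | zero => simp
    | succ k ih => intro f; simp [pow_succ, pd_res, ih]
  have key : ∀ l : List (Fin n),
      (l.map fun i => (pd i : Module.End ℂ (Smooth V)) ^ α i).prod (res h f) =
        res h ((l.map fun i => (pd i : Module.End ℂ (Smooth Ω)) ^ α i).prod f) := by
    intro l
    induction l with
    | nil => simp
    | cons a l ih => simp [ih, hpow]
  exact key _

/-- A compact subset of a smaller open set. -/
def CptIn.up (h : V ≤ Ω) (K : CptIn V) : CptIn Ω := ⟨K.1, K.2.1, K.2.2.trans h⟩

lemma psemi_res (h : V ≤ Ω) (K : CptIn V) (j : ℕ) (f : Smooth Ω) :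
    psemi V (K, j) (res h f) = psemi Ω (K.up h, j) f := by
  refine eq_of_forall_ge_iff fun c => ?_
  by_cases hc : 0 ≤ c
  · rw [psemi_le_iff _ _ _ hc, psemi_le_iff _ _ _ hc]
    refine forall₂_congr fun α _ => forall₂_congr fun x hx => ?_
    rw [der_res, res_apply h _ (K.2.2 hx)]
  · exact ⟨fun h' => absurd ((apply_nonneg _ _).trans h') hc,
      fun h' => absurd ((apply_nonneg _ _).trans h') hc⟩

end Smooth

section Generalized

variable {n : ℕ} {Ω V : Opens (Rn n)}

/-- The Colombeau algebra `𝒢(Ω)`, as a topological module over the generalized numbers. -/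
abbrev G (Ω : Opens (Rn n)) : Type := GE (psemi Ω)

/-- Restriction of generalized functions to a smaller open set. -/
def resG (h : V ≤ Ω) : G Ω →ₗ[CTilde] G V :=
  GE.map (res h) fun k => ⟨(k.1.up h, k.2), fun f => (psemi_res h k.1 k.2 f).le⟩

/-- The derivative `∂^α` of generalized functions. -/
def derG (α : Fin n → ℕ) : G Ω →ₗ[CTilde] G Ω :=
  GE.map (der α) fun k =>
    ⟨(k.1, k.2 + (psemi_der_le k.1 α).choose), (psemi_der_le k.1 α).choose_spec k.2⟩

lemma derG_resG (h : V ≤ Ω) (α : Fin n → ℕ) (u : G Ω) :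
    derG α (resG h u) = resG h (derG α u) := by
  obtain ⟨u, hu, rfl⟩ := GE.ind u
  simp only [resG, derG, GE.map_mk, der_res]

/-- The support of a generalized function: the complement in `Ω` of the union of all open sets
on which it vanishes. -/
def gsupp (u : G Ω) : Set (Rn n) :=
  {x | x ∈ Ω ∧ ∀ (V : Opens (Rn n)) (h : V ≤ Ω), x ∈ V → resG h u ≠ 0}

lemma resG_resG {W : Opens (Rn n)} (h : V ≤ Ω) (h' : W ≤ V) (u : G Ω) :
    resG h' (resG h u) = resG (h'.trans h) u := by
  obtain ⟨u, hu, rfl⟩ := GE.ind u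
  simp only [resG, GE.map_mk]
  refine GE.mk_eq_mk.2 ?_
  convert isNegligible_zero _
  ext ε
  simp only [Pi.sub_apply, Pi.zero_apply, sub_eq_zero]
  refine Smooth.ext fun x hx => ?_
  rw [res_apply _ _ hx, res_apply _ _ hx, res_apply _ _ (h' hx)]

lemma gsupp_add (u v : G Ω) : gsupp (u + v) ⊆ gsupp u ∪ gsupp v := by
  rintro x ⟨hx, hV⟩
  by_contra hcon
  simp only [gsupp, Set.mem_union, Set.mem_ofPred_eq, hx, true_and, not_or, not_forall,
    not_not] at hcon
  obtain ⟨⟨V, hVΩ, hxV, h1⟩, ⟨W, hWΩ, hxW, h2⟩⟩ := hcon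
  refine hV (V ⊓ W) (inf_le_left.trans hVΩ) ⟨hxV, hxW⟩ ?_
  rw [map_add, ← resG_resG hVΩ inf_le_left u, ← resG_resG hWΩ inf_le_right v, h1, h2]
  simp

lemma gsupp_smul (c : CTilde) (u : G Ω) : gsupp (c • u) ⊆ gsupp u := by
  rintro x ⟨hx, hV⟩
  refine ⟨hx, fun V h hxV h0 => hV V h hxV ?_⟩
  rw [map_smul, h0, smul_zero]

lemma gsupp_derG (α : Fin n → ℕ) (u : G Ω) : gsupp (derG α u) ⊆ gsupp u := by
  rintro x ⟨hx, hV⟩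
  refine ⟨hx, fun V h hxV h0 => hV V h hxV ?_⟩
  rw [← derG_resG, h0, map_zero]

lemma gsupp_zero : gsupp (0 : G Ω) = ∅ := by
  refine Set.eq_empty_of_forall_notMem fun x hx => ?_
  exact hx.2 Ω le_rfl hx.1 (map_zero _)

/-- The generalized functions with compact support, as a submodule. -/
def gcSub (Ω : Opens (Rn n)) : Submodule CTilde (G Ω) where
  carrier := {u | ∃ K : CptIn Ω, gsupp u ⊆ K.1}
  add_mem' := by
    rintro u v ⟨K, hK⟩ ⟨L, hL⟩
    exact ⟨⟨K.1 ∪ L.1, K.2.1.union L.2.1, Set.union_subset K.2.2 L.2.2⟩,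
      (gsupp_add u v).trans (Set.union_subset_union hK hL)⟩
  zero_mem' := ⟨⟨∅, isCompact_empty, Set.empty_subset _⟩, by simp [gsupp_zero]⟩
  smul_mem' := by
    rintro c u ⟨K, hK⟩
    exact ⟨K, (gsupp_smul c u).trans hK⟩

/-- The module `𝒢_c(Ω)` of generalized functions with compact support. -/
def Gc (Ω : Opens (Rn n)) : Type := gcSub Ω

instance : AddCommGroup (Gc Ω) := inferInstanceAs (AddCommGroup (gcSub Ω))

instance : Module CTilde (Gc Ω) := inferInstanceAs (Module CTilde (gcSub Ω))

/-- The inclusion of `𝒢_c(Ω)` into `𝒢(Ω)`. -/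
def Gc.incl : Gc Ω →ₗ[CTilde] G Ω := (gcSub Ω).subtype

/-- The submodule `𝒢_K(Ω)` of the generalized functions with support in `K`. -/
def GK (K : CptIn Ω) : Submodule CTilde (Gc Ω) where
  carrier := {u | gsupp u.incl ⊆ K.1}
  add_mem' := fun {u v} hu hv => by
    change gsupp (u.incl + v.incl) ⊆ K.1
    exact (gsupp_add _ _).trans (Set.union_subset hu hv)
  zero_mem' := by
    change gsupp (0 : G Ω) ⊆ K.1
    simp [gsupp_zero]
  smul_mem' := fun c u hu => by
    change gsupp (c • u.incl) ⊆ K.1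
    exact (gsupp_smul _ _).trans hu

/-- The topology of `𝒢_K(Ω)` given by the ultra-pseudo-seminorms of the orders `j ∈ J`, computed
on the compact sets that contain `K` in their interior. -/
abbrev topGK (J : Set ℕ) (K : CptIn Ω) : TopologicalSpace (GK K) :=
  upsTopology fun (k : {L : CptIn Ω // K.1 ⊆ interior L.1} × J) (u : GK K) =>
    GE.ups (p := psemi Ω) (k.1.1, k.2.1) u.1.incl

/-- The strict inductive limit topology on `𝒢_c(Ω)` built from the orders in `J`. -/
abbrev topGc (J : Set ℕ) (Ω : Opens (Rn n)) : TopologicalSpace (Gc Ω) :=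
  limTopology (fun K : CptIn Ω => GK K) fun K => topGK J K

/-- The topology of `𝒢_c(Ω)`: derivatives of all orders. -/
instance : TopologicalSpace (Gc Ω) := topGc Set.univ Ω

/-- The module `𝒢_c^m(Ω)`: the same module as `𝒢_c(Ω)` with a coarser topology. -/
def GcOrd (_m : ℕ) (Ω : Opens (Rn n)) : Type := Gc Ω

variable {m : ℕ}

instance : AddCommGroup (GcOrd m Ω) := inferInstanceAs (AddCommGroup (Gc Ω))

instance : Module CTilde (GcOrd m Ω) := inferInstanceAs (Module CTilde (Gc Ω))

/-- The topology of `𝒢_c^m(Ω)`: only derivatives up to the order `m`. -/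
instance : TopologicalSpace (GcOrd m Ω) := topGc {m} Ω

/-- The identity map from `𝒢_c(Ω)` to `𝒢_c^m(Ω)`. -/
def GcOrd.equiv : Gc Ω ≃ₗ[CTilde] GcOrd m Ω := LinearEquiv.refl CTilde (Gc Ω)

/-- A functional on `𝒢_c^m(Ω)` regarded as a functional on `𝒢_c(Ω)`. -/
def onGc (F : GcOrd m Ω →L[CTilde] CTilde) : Gc Ω →ₗ[CTilde] CTilde :=
  F.toLinearMap ∘ₗ GcOrd.equiv.toLinearMap

/-- The derivative `∂^α` on `𝒢_c(Ω)`. -/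
def derGc (α : Fin n → ℕ) : Gc Ω →ₗ[CTilde] Gc Ω :=
  (derG α).restrict (p := gcSub Ω) (q := gcSub Ω)
    fun u ⟨K, hK⟩ => ⟨K, (gsupp_derG α u).trans hK⟩

/-- The derivative `∂^α` of a functional: `(∂^α T) u = (-1) ^ |α| T (∂^α u)`. -/
def dualDer (α : Fin n → ℕ) (T : Gc Ω →ₗ[CTilde] CTilde) : Gc Ω →ₗ[CTilde] CTilde :=
  ((-1 : CTilde) ^ ∑ i, α i) • T ∘ₗ derGc α

end Generalized

section TestNets

variable {n : ℕ} {Ω V : Opens (Rn n)}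

/-- A test function on `Ω` regarded as a smooth function on `Ω`. -/
def ofTest : 𝓓(Ω, ℂ) →ₗ[ℂ] Smooth Ω where
  toFun f := ⟨f, f.contDiff.contDiffOn, fun _ hx =>
    image_eq_zero_of_notMem_tsupport fun h => hx (f.tsupport_subset h)⟩
  map_add' _ _ := rfl
  map_smul' _ _ := rfl

/-- The moderate nets of test functions on `Ω` whose supports lie in a common compact subset of
`Ω`, that is the union over `K` of the moderate nets in `𝓓_K(Ω)`. -/
def cptNets (Ω : Opens (Rn n)) : Submodule modNum (Eps → 𝓓(Ω, ℂ)) where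
  carrier := {u | (∃ K : CptIn Ω, ∀ ε, tsupport (u ε) ⊆ K.1) ∧
    IsModerate (psemi Ω) fun ε => ofTest (u ε)}
  add_mem' := by
    rintro u v ⟨⟨K, hK⟩, hu⟩ ⟨⟨L, hL⟩, hv⟩
    refine ⟨⟨⟨K.1 ∪ L.1, K.2.1.union L.2.1, Set.union_subset K.2.2 L.2.2⟩, fun ε => ?_⟩, ?_⟩
    · exact (tsupport_add (u ε) (v ε)).trans (Set.union_subset_union (hK ε) (hL ε))
    · exact hu.add hv
  zero_mem' := by
    refine ⟨⟨⟨∅, isCompact_empty, Set.empty_subset _⟩, fun ε => ?_⟩, isModerate_zero _⟩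
    have : ((0 : 𝓓(Ω, ℂ)) : Rn n → ℂ) = 0 := rfl
    simp [this]
  smul_mem' := by
    rintro c u ⟨⟨K, hK⟩, hu⟩
    refine ⟨⟨K, fun ε => ?_⟩, IsModerate.smul c.2 hu⟩
    refine (closure_mono fun x hx => ?_).trans (hK ε)
    exact fun h => hx (by
      change c.1 ε * u ε x = 0
      rw [h, mul_zero])

instance : SMul modNum (cptNets Ω) := ⟨fun c u => ⟨c • u.1, (cptNets Ω).smul_mem c u.2⟩⟩

lemma gsupp_mk_subset {u : Eps → Smooth Ω} (hu : IsModerate (psemi Ω) u) {K : Set (Rn n)}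
    (hK : IsClosed K) (h : ∀ ε, ∀ x ∉ K, u ε x = 0) : gsupp (GE.mk u hu : G Ω) ⊆ K := by
  rintro x ⟨hx, hV⟩
  by_contra hxK
  refine hV (Ω ⊓ ⟨Kᶜ, hK.isOpen_compl⟩) inf_le_left ⟨hx, hxK⟩ ?_
  rw [resG, GE.map_mk, GE.mk_eq_zero]
  convert isNegligible_zero _ with ε
  refine Smooth.ext fun y hy => ?_
  rw [res_apply _ _ hy, h ε y hy.2]
  rfl

/-- The class in `𝒢_c(Ω)` of a moderate net of test functions supported in a common compact set. -/
def cls (u : cptNets Ω) : Gc Ω :=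
  ⟨GE.mk (fun ε => ofTest (u.1 ε)) u.2.2, by
    obtain ⟨K, hK⟩ := u.2.1
    exact ⟨K, gsupp_mk_subset _ K.2.1.isClosed fun ε x hx =>
      image_eq_zero_of_notMem_tsupport fun h => hx (hK ε h)⟩⟩

lemma incl_injective : Function.Injective (Gc.incl : Gc Ω → G Ω) := Subtype.val_injective

lemma incl_cls (u : cptNets Ω) : (cls u).incl = GE.mk (fun ε => ofTest (u.1 ε)) u.2.2 := rfl

lemma cls_add (u v : cptNets Ω) : cls (u + v) = cls u + cls v := rfl

lemma cls_smul (z : Eps → ℂ) (hz : IsModerate absFamily z) (u : cptNets Ω) :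
    cls ((⟨z, hz⟩ : modNum) • u) = CTilde.mk z hz • cls u := rfl

lemma der_eq_zero_of_eventuallyEq {x : Rn n} (hx : x ∈ Ω) {f : Smooth Ω}
    (h : (f : Rn n → ℂ) =ᶠ[𝓝 x] 0) (α : Fin n → ℕ) : der α f x = 0 := by
  obtain ⟨W, hW, hWo, hxW⟩ := eventually_nhds_iff.1 h
  have hle : Ω ⊓ ⟨W, hWo⟩ ≤ Ω := inf_le_left
  have h0 : res hle f = 0 := Smooth.ext fun y hy => by
    rw [res_apply _ _ hy, hW y hy.2]
    rfl
  rw [← res_apply hle (der α f) ⟨hx, hxW⟩, ← der_res, h0, map_zero]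
  rfl

/-- The product of smooth functions. -/
def Smooth.mul (χ f : Smooth Ω) : Smooth Ω :=
  ⟨fun x => χ x * f x, χ.2.1.mul f.2.1, fun x hx => by
    change χ x * f x = 0
    rw [f.2.2 x hx, mul_zero]⟩

lemma pd_mul (i : Fin n) (χ f : Smooth Ω) :
    pd i (χ.mul f) = (pd i χ).mul f + χ.mul (pd i f) := Smooth.ext fun x hx => by
  rw [Smooth.add_apply, pd_apply _ _ hx]
  change _ = pd i χ x * f x + χ x * pd i f x
  rw [pd_apply _ _ hx, pd_apply _ _ hx]
  have : fderiv ℝ (χ.mul f) x = χ x • fderiv ℝ f x + f x • fderiv ℝ χ x :=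
    fderiv_mul (χ.differentiableAt hx) (f.differentiableAt hx)
  rw [this]
  simp
  ring

lemma psemi_mono (K : CptIn Ω) {i j : ℕ} (hij : i ≤ j) (f : Smooth Ω) :
    psemi Ω (K, i) f ≤ psemi Ω (K, j) f :=
  (psemi_le_iff _ _ _ (apply_nonneg _ _)).2 fun _ hα _ hx => le_psemi K f (hα.trans hij) hx

lemma psemi_mul_le (K : CptIn Ω) (j : ℕ) : ∀ χ : Smooth Ω, ∃ C : ℝ, 0 ≤ C ∧
    ∀ f : Smooth Ω, psemi Ω (K, j) (χ.mul f) ≤ C * psemi Ω (K, j) f := by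
  have h0 : ∀ χ f : Smooth Ω, psemi Ω (K, 0) (χ.mul f) ≤ psemi Ω (K, 0) χ * psemi Ω (K, 0) f := by
    intro χ f
    refine (psemi_le_iff _ _ _ (mul_nonneg (apply_nonneg _ _) (apply_nonneg _ _))).2
      fun α hα x hx => ?_
    have hα0 : α = 0 := by
      funext i
      exact Nat.le_zero.1
        ((Finset.single_le_sum (fun _ _ => Nat.zero_le _) (Finset.mem_univ i)).trans hα)
    subst hα0
    have h1 := le_psemi K χ (α := 0) (j := 0) (by simp) hx
    have h2 := le_psemi K f (α := 0) (j := 0) (by simp) hx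
    rw [der_zero, Module.End.one_apply] at h1 h2 ⊢
    change ‖χ x * f x‖ ≤ _
    rw [norm_mul]
    exact mul_le_mul h1 h2 (norm_nonneg _) (apply_nonneg _ _)
  induction j with
  | zero => exact fun χ => ⟨_, apply_nonneg _ _, h0 χ⟩
  | succ j ih =>
    intro χ
    choose C hC0 hC using ih
    set D : ℝ := psemi Ω (K, 0) χ + C χ + ∑ i, C (pd i χ) with hD
    have hS : ∀ i, C (pd i χ) ≤ ∑ i, C (pd i χ) := fun i =>
      Finset.single_le_sum (f := fun i => C (pd i χ)) (fun i _ => hC0 _) (Finset.mem_univ i)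
    have hS0 : 0 ≤ ∑ i, C (pd i χ) := Finset.sum_nonneg fun i _ => hC0 _
    have hp0 : 0 ≤ psemi Ω (K, 0) χ := apply_nonneg _ _
    have hD0 : 0 ≤ D := by have := hC0 χ; positivity
    refine ⟨D, hD0, fun f => ?_⟩
    have hf0 : 0 ≤ psemi Ω (K, j + 1) f := apply_nonneg _ _
    refine psemi_succ_le K j _ (mul_nonneg hD0 hf0) ?_ fun i => ?_
    · refine (h0 χ f).trans (mul_le_mul ?_ (psemi_mono K (Nat.zero_le _) f) (apply_nonneg _ _) hD0)
      have := hC0 χ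
      linarith
    · rw [pd_mul]
      refine (map_add_le_add _ _ _).trans ?_
      have h1 := (hC (pd i χ) f).trans
        (mul_le_mul_of_nonneg_left (psemi_mono K (Nat.le_succ j) f) (hC0 _))
      have h2 := (hC χ (pd i f)).trans
        (mul_le_mul_of_nonneg_left (psemi_pd_le K j i f) (hC0 _))
      have h3 := mul_le_mul_of_nonneg_right (hS i) hf0
      have h4 := mul_nonneg hp0 hf0
      calc _ ≤ C (pd i χ) * psemi Ω (K, j + 1) f + C χ * psemi Ω (K, j + 1) f := add_le_add h1 h2
        _ ≤ D * psemi Ω (K, j + 1) f := by rw [hD]; nlinarith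

/-- A generalized function is negligible on the compact sets disjoint from its support. -/
lemma negligible_off_gsupp {u : Eps → Smooth Ω} (hu : IsModerate (psemi Ω) u) (K : CptIn Ω)
    (hK : Disjoint K.1 (gsupp (GE.mk u hu : G Ω))) (j q : ℕ) :
    IsOrd (fun ε => psemi Ω (K, j) (u ε)) q := by
  have key : ∃ L : CptIn Ω, K.1 ⊆ L.1 ∧ ∀ j q : ℕ, IsOrd (fun ε => psemi Ω (L, j) (u ε)) q := by
    refine K.2.1.induction_on (p := fun s => ∃ L : CptIn Ω, s ⊆ L.1 ∧ ∀ j q : ℕ,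
      IsOrd (fun ε => psemi Ω (L, j) (u ε)) q) ?_ ?_ ?_ ?_
    · refine ⟨⟨∅, isCompact_empty, Set.empty_subset _⟩, Set.Subset.rfl, fun j q => ?_⟩
      convert isOrd_zero _ using 2
      refine le_antisymm ((psemi_le_iff _ _ _ le_rfl).2 fun _ _ x hx => ?_) (apply_nonneg _ _)
      exact absurd hx (Set.notMem_empty x)
    · rintro s t hst ⟨L, hL, h⟩
      exact ⟨L, hst.trans hL, h⟩
    · rintro s t ⟨L, hL, h⟩ ⟨M, hM, h'⟩
      refine ⟨⟨L.1 ∪ M.1, L.2.1.union M.2.1, Set.union_subset L.2.2 M.2.2⟩,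
        Set.union_subset_union hL hM, fun j q => ?_⟩
      refine ((h j q).add (h' j q)).of_le (C := 1) fun ε => ?_
      have hL0 : 0 ≤ psemi Ω (L, j) (u ε) := apply_nonneg _ _
      have hM0 : 0 ≤ psemi Ω (M, j) (u ε) := apply_nonneg _ _
      rw [abs_of_nonneg (apply_nonneg _ _), abs_of_nonneg (add_nonneg hL0 hM0), one_mul]
      refine (psemi_le_iff _ _ _ (add_nonneg hL0 hM0)).2 fun α hα x hx => ?_
      rcases hx with hx | hx
      · exact (le_psemi L (u ε) hα hx).trans (le_add_of_nonneg_right hM0)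
      · exact (le_psemi M (u ε) hα hx).trans (le_add_of_nonneg_left hL0)
    · intro x hx
      have hxs : x ∉ gsupp (GE.mk u hu : G Ω) := Set.disjoint_left.1 hK hx
      simp only [gsupp, Set.mem_ofPred_eq, not_and, not_forall, not_not] at hxs
      obtain ⟨W, hW, hxW, h0⟩ := hxs (K.2.2 hx)
      obtain ⟨L, hL, hxL, hLW⟩ := exists_compact_subset W.isOpen hxW
      refine ⟨L, mem_nhdsWithin_of_mem_nhds (mem_interior_iff_mem_nhds.1 hxL),
        ⟨L, hL, hLW.trans hW⟩, Set.Subset.rfl, fun j q => ?_⟩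
      rw [resG, GE.map_mk, GE.mk_eq_zero] at h0
      have := h0 (⟨L, hL, hLW⟩, j) q
      simp only [psemi_res] at this
      exact this
  obtain ⟨L, hKL, h⟩ := key
  refine (h j q).of_le (C := 1) fun ε => ?_
  rw [abs_of_nonneg (apply_nonneg _ _), abs_of_nonneg (apply_nonneg _ _), one_mul]
  exact (psemi_le_iff _ _ _ (apply_nonneg _ _)).2 fun α hα x hx => le_psemi L _ hα (hKL hx)

/-- Every element of `𝒢_c(Ω)` has a representative supported in a fixed compact subset of `Ω`. -/
lemma cls_surjective (w : Gc Ω) : ∃ u : cptNets Ω, cls u = w := by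
  obtain ⟨w, K, hK⟩ := w
  obtain ⟨u, hu, rfl⟩ := GE.ind w
  obtain ⟨L, hL, hKL, hLΩ⟩ := exists_compact_between K.2.1 Ω.isOpen K.2.2
  obtain ⟨χ₀, h1, h0, -⟩ := exists_contMDiffMap_one_nhds_of_subset_interior
    (n := (⊤ : ℕ∞)) (modelWithCornersSelf ℝ (Rn n)) K.2.1.isClosed hKL
  have hχ₀ : ContDiff ℝ ∞ χ₀ := χ₀.contMDiff.contDiff
  set χ : Rn n → ℂ := fun x => (χ₀ x : ℂ) with hχdef
  have hχ : ContDiff ℝ ∞ χ := Complex.ofRealCLM.contDiff.comp hχ₀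
  have hχ0 : ∀ x ∉ L, χ x = 0 := fun x hx => by simp [hχdef, h0 x hx]
  have hsupp : ∀ f : Rn n → ℂ, tsupport (fun x => χ x * f x) ⊆ L := fun f =>
    closure_minimal (fun x hx => by
      by_contra hxL
      exact hx (by simp [hχ0 x hxL])) hL.isClosed
  let χΩ : Smooth Ω := ⟨χ, hχ.contDiffOn, fun x hx => hχ0 x fun h => hx (hLΩ h)⟩
  let v : Eps → 𝓓(Ω, ℂ) := fun ε => ⟨fun x => χ x * u ε x, by
      refine contDiff_iff_contDiffAt.2 fun x => ?_
      by_cases hx : x ∈ Ω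
      · exact hχ.contDiffAt.mul ((u ε).contDiffAt hx)
      · have hxL : x ∈ Lᶜ := fun h => hx (hLΩ h)
        have : (fun x => χ x * u ε x) =ᶠ[𝓝 x] fun _ => 0 :=
          (hL.isClosed.isOpen_compl.eventually_mem hxL).mono fun y hy => by
            simp [hχ0 y hy]
        exact contDiffAt_const.congr_of_eventuallyEq this,
    hL.of_isClosed_subset (isClosed_tsupport _) (hsupp _), (hsupp _).trans hLΩ⟩
  have hv : ∀ ε, ofTest (v ε) = χΩ.mul (u ε) := fun ε => rfl
  have hvm : IsModerate (psemi Ω) fun ε => ofTest (v ε) := by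
    rintro ⟨K', j⟩
    obtain ⟨N, hN⟩ := hu (K', j)
    obtain ⟨C, hC0, hC⟩ := psemi_mul_le K' j χΩ
    refine ⟨N, hN.of_le (C := C) fun ε => ?_⟩
    rw [abs_of_nonneg (apply_nonneg _ _), abs_of_nonneg (apply_nonneg _ _)]
    exact hC _
  refine ⟨⟨v, ⟨⟨L, hL, hLΩ⟩, fun ε => hsupp _⟩, hvm⟩, incl_injective ?_⟩
  rw [incl_cls]
  refine GE.mk_eq_mk.2 ?_
  obtain ⟨W, hWo, hKW, hW⟩ : ∃ W : Set (Rn n), IsOpen W ∧ K.1 ⊆ W ∧ ∀ x ∈ W, χ₀ x = 1 := by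
    obtain ⟨W, hWo, hKW, hW⟩ := mem_nhdsSet_iff_exists.1 h1
    exact ⟨W, hWo, hKW, hW⟩
  rintro ⟨M, j⟩ q
  let M' : CptIn Ω := ⟨M.1 \ W, M.2.1.diff hWo, Set.sdiff_subset.trans M.2.2⟩
  have hM' : Disjoint M'.1 (gsupp (GE.mk u hu : G Ω)) :=
    Set.disjoint_left.2 fun x hx hxs => hx.2 (hKW (hK hxs))
  obtain ⟨C, hC0, hC⟩ := psemi_mul_le M' j χΩ
  refine (negligible_off_gsupp hu M' hM' j q).of_le (C := C + 1) fun ε => ?_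
  have hp0 : 0 ≤ psemi Ω (M', j) (u ε) := apply_nonneg _ _
  rw [abs_of_nonneg (apply_nonneg _ _), abs_of_nonneg hp0]
  refine (psemi_le_iff _ _ _ (mul_nonneg (by linarith) hp0)).2 fun α hα x hx => ?_
  by_cases hxW : x ∈ W
  · rw [der_eq_zero_of_eventuallyEq (M.2.2 hx), norm_zero]
    · exact mul_nonneg (by linarith) hp0
    · refine (hWo.eventually_mem hxW).mono fun y hy => ?_
      change χ y * u ε y - u ε y = 0
      simp [hχdef, hW y hy]
  · refine (le_psemi M' _ hα ⟨hx, hxW⟩).trans ?_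
    change psemi Ω (M', j) (χΩ.mul (u ε) - u ε) ≤ _
    refine (map_sub_le_add _ _ _).trans ?_
    have := hC (u ε)
    linarith

lemma psemi_ofTest_mono (h : V ≤ Ω) (K : CptIn V) (L : CptIn Ω) (j : ℕ) (f : 𝓓(V, ℂ))
    (g : 𝓓(Ω, ℂ)) (hfg : (f : Rn n → ℂ) = g) (hf : tsupport f ⊆ K.1) :
    psemi Ω (L, j) (ofTest g) ≤ psemi V (K, j) (ofTest f) := by
  refine (psemi_le_iff _ _ _ (apply_nonneg _ _)).2 fun α hα x hx => ?_
  by_cases hxf : x ∈ tsupport f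
  · have hxK := hf hxf
    have : res h (ofTest g) = ofTest f := Smooth.ext fun y hy => by
      rw [res_apply h _ hy]
      exact (congrFun hfg y).symm
    rw [← res_apply h (der α (ofTest g)) (K.2.2 hxK), ← der_res, this]
    exact le_psemi K _ hα hxK
  · rw [der_eq_zero_of_eventuallyEq (L.2.2 hx), norm_zero]
    · exact apply_nonneg _ _
    · change (g : Rn n → ℂ) =ᶠ[𝓝 x] 0
      rw [← hfg]
      exact notMem_tsupport_iff_eventuallyEq.1 hxf

/-- Extension by zero of test functions to a larger open set. -/
def extTest (h : V ≤ Ω) (f : 𝓓(V, ℂ)) : 𝓓(Ω, ℂ) :=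
  ⟨f, f.contDiff, f.hasCompactSupport, f.tsupport_subset.trans h⟩

/-- Extension by zero of nets of test functions to a larger open set. -/
def extNet (h : V ≤ Ω) (u : cptNets V) : cptNets Ω :=
  ⟨fun ε => extTest h (u.1 ε), by
    obtain ⟨⟨K, hK⟩, hu⟩ := u.2
    refine ⟨⟨K.up h, hK⟩, ?_⟩
    rintro ⟨L, j⟩
    obtain ⟨N, hN⟩ := hu (K, j)
    refine ⟨N, hN.of_le (C := 1) fun ε => ?_⟩
    rw [abs_of_nonneg (apply_nonneg _ _), abs_of_nonneg (apply_nonneg _ _), one_mul]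
    exact psemi_ofTest_mono h K L j _ _ rfl (hK ε)⟩

lemma cls_extNet_congr (h : V ≤ Ω) {u v : cptNets V} (huv : cls u = cls v) :
    cls (extNet h u) = cls (extNet h v) := by
  have h0 : IsNegligible (psemi V) _ := GE.mk_eq_mk.1 (congrArg Gc.incl huv)
  refine incl_injective (GE.mk_eq_mk.2 ?_)
  obtain ⟨K, hK⟩ := (u - v).2.1
  rintro ⟨L, j⟩ q
  refine (h0 (K, j) q).of_le (C := 1) fun ε => ?_
  rw [abs_of_nonneg (apply_nonneg _ _), abs_of_nonneg (apply_nonneg _ _), one_mul]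
  exact psemi_ofTest_mono h K L j ((u - v).1 ε) (extTest h (u.1 ε) - extTest h (v.1 ε)) rfl (hK ε)

/-- Extension by zero of generalized functions with compact support: it maps the class of a net
of test functions in `𝒢_c(V)` to the class of the same net in `𝒢_c(Ω)`, see `extGc_cls`. -/
def extGc (h : V ≤ Ω) : Gc V →ₗ[CTilde] Gc Ω where
  toFun w := cls (extNet h (cls_surjective w).choose)
  map_add' w w' := by
    have hw := (cls_surjective w).choose_spec
    have hw' := (cls_surjective w').choose_spec
    rw [← cls_add]
    refine (cls_extNet_congr h (v := (cls_surjective w).choose + (cls_surjective w').choose)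
      ?_).trans rfl
    rw [(cls_surjective (w + w')).choose_spec, cls_add, hw, hw']
  map_smul' c w := by
    obtain ⟨z, hz, rfl⟩ := CTilde.ind c
    rw [RingHom.id_apply, ← cls_smul]
    refine (cls_extNet_congr h (v := (⟨z, hz⟩ : modNum) • (cls_surjective w).choose)
      ?_).trans rfl
    rw [(cls_surjective (CTilde.mk z hz • w)).choose_spec, cls_smul,
      (cls_surjective w).choose_spec]

lemma extGc_cls (h : V ≤ Ω) (u : cptNets V) : extGc h (cls u) = cls (extNet h u) :=
  cls_extNet_congr h (cls_surjective (cls u)).choose_spec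

/-- The restriction of a functional to a smaller open set. -/
def restrictFun (h : V ≤ Ω) (T : Gc Ω →ₗ[CTilde] CTilde) : Gc V →ₗ[CTilde] CTilde :=
  T ∘ₗ extGc h

/-- A functional on `𝒢_c(Ω)` is basic: it is given by a net of distributions that is moderate. -/
def IsBasicGc (T : Gc Ω →L[CTilde] CTilde) : Prop :=
  ∃ t : Eps → (𝓓(Ω, ℂ) →L[ℂ] ℂ),
    (∀ K : CptIn Ω, ∃ j : ℕ, ∃ c : ℝ, 0 < c ∧ ∃ N : ℕ, ∃ η : Eps,
      ∀ f : 𝓓(Ω, ℂ), tsupport f ⊆ K.1 → ∀ ε : Eps, ε ≤ η →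
        ‖t ε f‖ ≤ c * (ε : ℝ) ^ (-(N : ℝ)) * psemi Ω (K, j) (ofTest f)) ∧
    ∀ u : cptNets Ω, Represents (T (cls u)) fun ε => t ε (u.1 ε)

/-- A functional on `𝒢(Ω)` is basic: it is given by a net of compactly supported distributions
that is moderate. -/
def IsBasicG (T : G Ω →L[CTilde] CTilde) : Prop :=
  ∃ t : Eps → (Smooth Ω →L[ℂ] ℂ),
    (∃ K : CptIn Ω, ∃ j : ℕ, ∃ c : ℝ, 0 < c ∧ ∃ N : ℕ, ∃ η : Eps,
      ∀ f : Smooth Ω, ∀ ε : Eps, ε ≤ η →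
        ‖t ε f‖ ≤ c * (ε : ℝ) ^ (-(N : ℝ)) * psemi Ω (K, j) f) ∧
    ∀ (u : Eps → Smooth Ω) (hu : IsModerate (psemi Ω) u),
      Represents (T (GE.mk u hu)) fun ε => t ε (u ε)

/-- The seminorms `sup_{x ∈ K} |f x|` on the continuous functions on `Ω`. -/
def contSemi (Ω : Opens (Rn n)) : SeminormFamily ℂ C(Ω, ℂ) (Compacts Ω) :=
  fun K => (normSeminorm ℂ C(K, ℂ)).comp (σ₁₂ := RingHom.id ℂ)
    { toFun := fun f : C(Ω, ℂ) => f.restrict (K : Set Ω)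
      map_add' := fun _ _ => rfl
      map_smul' := fun (_ : ℂ) _ => rfl }

/-- The functional `T` on `𝒢_c(Ω)` is defined by the net `f` of continuous functions on `Ω`:
`T u` is the class of the net of the integrals of `f_ε u_ε`. -/
def IsDefinedBy (T : Gc Ω →ₗ[CTilde] CTilde) (f : Eps → C(Ω, ℂ)) : Prop :=
  ∀ u : cptNets Ω, Represents (T (cls u)) fun ε => 
    ∫ x : Ω, f ε x * u.1 ε x ∂(MeasureTheory.volume.comap Subtype.val)

end TestNets

end Colombeau

end

open Colombeau

/-! Everything rests on a quantitative form of the local structure theorem for distributions. Let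
$t$ be a functional on test functions of a bounded open set with $|t(\varphi)|\le
M\,p_{K,j}(\varphi)$. Then $t(\varphi)=\int f\,\partial^\alpha\varphi$ with $f$ continuous and
$|f|\le C M$, where $\alpha$ and $C$ depend on the set and on $j$ but not on $t$
(`exists_continuous_der_eq`). A basic functional is given by functionals $T_\varepsilon$ with one
$j$ and with $M=c\,\varepsilon^{-N}$ for all small $\varepsilon$, so the theorem may be applied for
each $\varepsilon$ separately: one $\alpha$ serves all of them and the resulting net is moderate
(`exists_net_der_eq`).

For the local theorem put $J=(j,\dots,j)$ and $\mathbf 1=(1,\dots,1)$. On functions supported in a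
fixed ball, $p_{K,j}(\varphi)$ is at most a constant times $\sup|\partial^J\varphi|$
(`psemi_le_of_norm_der_le`). A test function is the integral of its mixed derivative
$\partial^{\mathbf 1}$ over an orthant (`setIntegral_orthant_der_one`), so this supremum is at most
a constant times the $L^2$ norm of $\partial^{\mathbf 1+J}\varphi$. By Hahn–Banach and Riesz,
$t(\varphi)=\langle g,\partial^{\mathbf 1+J}\varphi\rangle$ with $g\in L^2$
(`exists_inner_eq_of_norm_le`). Integrating once more over orthants replaces $\bar g$ by a bounded
continuous function (`integral_mul_eq_integral_mul_der_one`, `continuous_setIntegral_orthant`),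
whence $\alpha=(j+2,\dots,j+2)$.

For the global statement, a cutoff $\chi$ equal to 1 near the compact set that controls the net
gives $T_\varepsilon u=T_\varepsilon(\chi u)$. The local theorem applies to $\chi u$, and the
Leibniz rule turns $\partial^\alpha(\chi u)$ into a sum of terms $a_\beta\,\partial^\beta u$ with
$|\beta|\le|\alpha|$ (`isDiffOp_der_mul`).

It remains to see that a moderate net of continuous functions defines a continuous functional on
$\mathcal G^0_c$. The delicate point is a loss exponent uniform over $\mathcal G_K$, although
representatives may have supports larger than $K$; outside a neighbourhood of the generalized
support they are negligible (`isOrd_pairing`). -/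

namespace Colombeau

/-! ### Valuation and topology of the generalized numbers -/

section Numbers

/-- The supremum defining the valuation need not be attained, so a lower bound $b$ yields only the
orders strictly below $b$. -/
lemma le_netVal_iff {a : Eps → ℝ} {b : ℝ} : (b : EReal) ≤ netVal a ↔ ∀ b' < b, IsOrd a b' := by
  constructor
  · intro h b' hb'
    have h1 : (b' : EReal) < netVal a := (EReal.coe_lt_coe_iff.2 hb').trans_le h
    simp only [netVal, lt_iSup_iff] at h1
    obtain ⟨c, hc, hbc⟩ := h1
    exact hc.mono (EReal.coe_lt_coe_iff.1 hbc).le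
  · intro h
    by_contra! hlt
    obtain ⟨c, hc1, hc2⟩ := EReal.lt_iff_exists_real_btwn.1 hlt
    have hc : (c : EReal) ≤ netVal a := le_iSup₂_of_le c (h c (EReal.coe_lt_coe_iff.1 hc2)) le_rfl
    exact absurd hc1 hc.not_gt

lemma isOrd_of_lt_netVal {a : Eps → ℝ} {b : ℝ} (h : (b : EReal) < netVal a) : IsOrd a b := by
  obtain ⟨c, hc1, hc2⟩ := EReal.lt_iff_exists_real_btwn.1 h
  exact le_netVal_iff.1 hc2.le b (EReal.coe_lt_coe_iff.1 hc1)

lemma le_netVal_of_isOrd {a : Eps → ℝ} {b : ℝ} (h : IsOrd a b) : (b : EReal) ≤ netVal a :=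
  le_iSup₂_of_le b h le_rfl

namespace CTilde

lemma val_mk (z : Eps → ℂ) (hz : IsModerate absFamily z) :
    (CTilde.mk z hz).val = netVal fun ε => ‖z ε‖ := rfl

lemma mk_add {z w : Eps → ℂ} (hz : IsModerate absFamily z) (hw : IsModerate absFamily w) :
    CTilde.mk (z + w) (hz.add hw) = CTilde.mk z hz + CTilde.mk w hw := rfl

lemma mk_mul {z w : Eps → ℂ} (hz : IsModerate absFamily z) (hw : IsModerate absFamily w) :
    CTilde.mk (z * w) (IsModerate.smul hz hw) = CTilde.mk z hz * CTilde.mk w hw := rfl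

lemma mk_eq_mk {z w : Eps → ℂ} {hz : IsModerate absFamily z} {hw : IsModerate absFamily w} :
    CTilde.mk z hz = CTilde.mk w hw ↔ IsNegligible absFamily (z - w) :=
  Ideal.Quotient.eq

lemma le_val_add {b : ℝ} {x y : CTilde} (hx : (b : EReal) ≤ x.val) (hy : (b : EReal) ≤ y.val) :
    (b : EReal) ≤ (x + y).val := by
  obtain ⟨z, hz, rfl⟩ := CTilde.ind x
  obtain ⟨w, hw, rfl⟩ := CTilde.ind y
  rw [← mk_add, val_mk, le_netVal_iff]
  rw [val_mk, le_netVal_iff] at hx hy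
  exact fun b' hb' => isOrd_seminorm_add (p := normSeminorm ℂ ℂ) (hx b' hb') (hy b' hb')

lemma le_val_mul {b c : ℝ} {x y : CTilde} (hx : (b : EReal) ≤ x.val) (hy : (c : EReal) ≤ y.val) :
    ((b + c : ℝ) : EReal) ≤ (x * y).val := by
  obtain ⟨z, hz, rfl⟩ := CTilde.ind x
  obtain ⟨w, hw, rfl⟩ := CTilde.ind y
  rw [← mk_mul, val_mk, le_netVal_iff]
  rw [val_mk, le_netVal_iff] at hx hy
  intro b' hb'
  -- The slack $b+c-b'>0$ is split evenly between the two factors.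
  have h := (hx (b - (b + c - b') / 2) (by linarith)).mul (hy (c - (b + c - b') / 2) (by linarith))
  simp only [Pi.mul_apply, norm_mul]
  convert h using 1
  ring

lemma le_val_zero (b : ℝ) : (b : EReal) ≤ (0 : CTilde).val := by
  have : (0 : CTilde) = CTilde.mk 0 (isModerate_zero _) := rfl
  rw [this, val_mk]
  exact le_netVal_of_isOrd (by simpa using isOrd_zero b)

lemma val_neg (x : CTilde) : (-x).val = x.val := by
  obtain ⟨z, hz, rfl⟩ := CTilde.ind x
  have hz' : IsModerate absFamily (-z) := modNum.neg_mem hz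
  have : -CTilde.mk z hz = CTilde.mk (-z) hz' := rfl
  rw [this, val_mk, val_mk]
  simp

lemma exists_le_val (x : CTilde) : ∃ b : ℝ, (b : EReal) ≤ x.val := by
  obtain ⟨z, hz, rfl⟩ := CTilde.ind x
  obtain ⟨N, hN⟩ := isModerate_num.1 hz
  exact ⟨_, le_netVal_of_isOrd hN⟩

lemma enorm_le_iff {x : CTilde} {b : ℝ} :
    x.enorm ≤ EReal.exp ((-b : ℝ) : EReal) ↔ (b : EReal) ≤ x.val := by
  rw [CTilde.enorm, EReal.exp_le_exp_iff, EReal.coe_neg, EReal.neg_le_neg_iff]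

lemma enorm_lt_iff {x : CTilde} {b : ℝ} :
    x.enorm < EReal.exp ((-b : ℝ) : EReal) ↔ (b : EReal) < x.val := by
  rw [CTilde.enorm, EReal.exp_lt_exp_iff, EReal.coe_neg, EReal.neg_lt_neg_iff]

lemma exists_exp_neg_lt {r : ENNReal} (hr : 0 < r) :
    ∃ b : ℝ, EReal.exp ((-b : ℝ) : EReal) < r := by
  obtain ⟨s, hs0, hsr⟩ := ENNReal.lt_iff_exists_real_btwn.1 hr
  refine ⟨-Real.log s, ?_⟩
  have hs : 0 < s := ENNReal.ofReal_pos.1 hsr.1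
  rw [neg_neg, EReal.exp_coe, Real.exp_log hs]
  exact hsr.2

lemma enorm_add_le (x y : CTilde) : (x + y).enorm ≤ max x.enorm y.enorm := by
  by_contra! h
  obtain ⟨hx, hy⟩ := max_lt_iff.1 h
  simp only [CTilde.enorm, EReal.exp_lt_exp_iff, EReal.neg_lt_neg_iff] at hx hy
  obtain ⟨b, hb1, hb2⟩ := EReal.lt_iff_exists_real_btwn.1 (lt_min hx hy)
  exact absurd (le_val_add (hb2.le.trans (min_le_left _ _)) (hb2.le.trans (min_le_right _ _)))
    hb1.not_ge

/-- The topology is generated by balls with arbitrary centres; by the strong triangle inequality a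
ball containing $x$ contains a ball centred at $x$, so the centred ones form a basis. -/
lemma hasBasis_nhds (x : CTilde) :
    (𝓝 x).HasBasis (fun _ : ℝ => True) fun b => {y | (b : EReal) ≤ (y - x).val} := by
  have key : 𝓝 x = ⨅ b : ℝ, 𝓟 {y : CTilde | (b : EReal) ≤ (y - x).val} := by
    refine le_antisymm (le_iInf fun b => le_principal_iff.2 ?_) ?_
    · refine mem_of_superset (IsOpen.mem_nhds (isOpen_generateFrom_of_mem
        ⟨(), x, EReal.exp ((-b : ℝ) : EReal), ?_, rfl⟩) ?_) ?_
      · rw [EReal.exp_coe]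
        exact ENNReal.ofReal_pos.2 (Real.exp_pos _)
      · change (x - x).enorm < _
        rw [sub_self, enorm_lt_iff]
        exact (EReal.coe_lt_coe_iff.2 (lt_add_one b)).trans_le (le_val_zero _)
      · exact fun y hy => (enorm_lt_iff.1 hy).le
    · rw [nhds_generateFrom]
      refine le_iInf₂ ?_
      rintro s ⟨hxs, _, x', r, hr, rfl⟩
      obtain ⟨b, hb⟩ := exists_exp_neg_lt hr
      refine iInf_le_of_le b (principal_mono.2 fun y hy => ?_)
      change (y - x').enorm < r
      rw [← sub_add_sub_cancel y x x']
      exact (enorm_add_le _ _).trans_lt (max_lt ((enorm_le_iff.2 hy).trans_lt hb) hxs)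
  rw [key]
  refine hasBasis_iInf_principal fun b c => ⟨max b c, fun y hy => ?_, fun y hy => ?_⟩
  · exact (EReal.coe_le_coe_iff.2 (le_max_left b c)).trans hy
  · exact (EReal.coe_le_coe_iff.2 (le_max_right b c)).trans hy

instance : IsTopologicalRing CTilde where
  continuous_add := by
    refine continuous_iff_continuousAt.2 fun ⟨x, y⟩ => ?_
    rw [ContinuousAt, nhds_prod_eq]
    refine (((hasBasis_nhds x).prod (hasBasis_nhds y)).tendsto_iff (hasBasis_nhds _)).2
      fun b _ => ⟨(b, b), ⟨trivial, trivial⟩, fun ⟨x', y'⟩ h => ?_⟩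
    change (b : EReal) ≤ (x' + y' - (x + y)).val
    rw [add_sub_add_comm]
    exact le_val_add h.1 h.2
  continuous_neg := by
    refine continuous_iff_continuousAt.2 fun x => ?_
    refine ((hasBasis_nhds x).tendsto_iff (hasBasis_nhds _)).2 fun b _ => ⟨b, trivial, fun y h => ?_⟩
    change (b : EReal) ≤ (-y - -x).val
    rw [← neg_sub', val_neg]
    exact h
  continuous_mul := by
    refine continuous_iff_continuousAt.2 fun ⟨x, y⟩ => ?_
    rw [ContinuousAt, nhds_prod_eq]
    refine (((hasBasis_nhds x).prod (hasBasis_nhds y)).tendsto_iff (hasBasis_nhds _)).2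
      fun b _ => ?_
    obtain ⟨cx, hcx⟩ := exists_le_val x
    obtain ⟨cy, hcy⟩ := exists_le_val y
    -- With $c_x,c_y$ lower bounds for the valuations of $x$ and $y$, these radii give valuation at
    -- least $b$ to each of $(x'-x)(y'-y)$, $(x'-x)y$ and $x(y'-y)$.
    refine ⟨(max 0 (b - cy), max b (b - cx)), ⟨trivial, trivial⟩, fun ⟨x', y'⟩ ⟨hx, hy⟩ => ?_⟩
    change (b : EReal) ≤ (x' * y' - x * y).val
    have e : x' * y' - x * y = (x' - x) * (y' - y) + ((x' - x) * y + x * (y' - y)) := by ring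
    have le1 : ∀ {p q : ℝ} {v : EReal}, p ≤ q → (q : EReal) ≤ v → (p : EReal) ≤ v :=
      fun h h' => (EReal.coe_le_coe_iff.2 h).trans h'
    rw [e]
    refine le_val_add ?_ (le_val_add ?_ ?_)
    · exact le1 (by linarith [le_max_left 0 (b - cy), le_max_left b (b - cx)]) (le_val_mul hx hy)
    · exact le1 (by linarith [le_max_right 0 (b - cy)]) (le_val_mul hx hcy)
    · exact le1 (by linarith [le_max_right b (b - cx)]) (le_val_mul hcx hy)

end CTilde

/-- Makes the topology pulled back along a linear functional a competitor in the definition of the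
inductive limit, so that continuity of the functional can be tested on each step. The sets of
valuation at least $b$ are closed under sums and under multipliers of norm at most one because the
valuation is ultrametric and superadditive on products. -/
lemma isLocallyConvex_induced {G : Type*} [AddCommGroup G] [Module CTilde G]
    (F : G →ₗ[CTilde] CTilde) :
    IsLocallyConvex (TopologicalSpace.induced F inferInstance) where
  addGroup := topologicalAddGroup_induced F
  smul := continuousSMul_induced F
  base U hU := by
    rw [nhds_induced, map_zero] at hU
    obtain ⟨V, hV, hVU⟩ := hU
    obtain ⟨b, -, hb⟩ := (CTilde.hasBasis_nhds 0).mem_iff.1 hV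
    refine ⟨F ⁻¹' {y | (b : EReal) ≤ (y - 0).val}, ?_, fun x hx => hVU (hb hx), ?_, ?_⟩
    · rw [nhds_induced, map_zero]
      exact preimage_mem_comap ((CTilde.hasBasis_nhds 0).mem_of_mem trivial)
    · intro x hx y hy
      simp only [Set.mem_preimage, Set.mem_ofPred_eq, sub_zero, map_add] at *
      exact CTilde.le_val_add hx hy
    · intro c hc x hx
      simp only [Set.mem_preimage, Set.mem_ofPred_eq, sub_zero, map_smul, smul_eq_mul] at *
      have h0 : ((0 : ℝ) : EReal) ≤ c.val := CTilde.enorm_le_iff.1 (by simpa using hc)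
      simpa using CTilde.le_val_mul h0 hx

end Numbers

/-! ### Computing with representing nets -/

section Represents

lemma Represents.eq {x y : CTilde} {z w : Eps → ℂ} (hx : Represents x z) (hy : Represents y w)
    (h : IsNegligible absFamily (z - w)) : x = y := by
  obtain ⟨hz, rfl⟩ := hx
  obtain ⟨hw, rfl⟩ := hy
  exact CTilde.mk_eq_mk.2 h

lemma Represents.add {x y : CTilde} {z w : Eps → ℂ} (hx : Represents x z) (hy : Represents y w) :
    Represents (x + y) (fun ε => z ε + w ε) := by
  obtain ⟨hz, rfl⟩ := hx
  obtain ⟨hw, rfl⟩ := hy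
  exact ⟨hz.add hw, rfl⟩

lemma Represents.zero : Represents 0 fun _ => 0 := ⟨isModerate_zero _, rfl⟩

lemma Represents.sum {ι : Type*} (s : Finset ι) {x : ι → CTilde} {z : ι → Eps → ℂ}
    (h : ∀ i, Represents (x i) (z i)) : Represents (∑ i ∈ s, x i) fun ε => ∑ i ∈ s, z i ε := by
  classical
  induction s using Finset.induction_on with
  | empty => simpa using Represents.zero
  | insert a s ha ih =>
    simp only [Finset.sum_insert ha]
    exact (h a).add ih

lemma Represents.neg_one_pow_mul {x : CTilde} {z : Eps → ℂ} (hx : Represents x z) (k : ℕ) :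
    Represents ((-1 : CTilde) ^ k * x) fun ε => (-1) ^ k * z ε := by
  obtain ⟨hz, rfl⟩ := hx
  let m : modNum := (-1) ^ k
  have hm : ∀ ε, m.1 ε = (-1) ^ k := fun ε => by simp [m]
  have hm' : IsModerate absFamily m.1 := m.2
  have h1 : (-1 : CTilde) ^ k = CTilde.mk m.1 hm' := by
    change _ = Ideal.Quotient.mk negNum ((-1) ^ k)
    rw [map_pow, map_neg, map_one]
    rfl
  rw [h1, ← CTilde.mk_mul]
  have h2 : (fun ε => (-1) ^ k * z ε) = m.1 * z := by
    ext ε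
    rw [Pi.mul_apply, hm]
  rw [h2]
  exact ⟨_, rfl⟩

/-- The estimates for basic functionals hold only for $\varepsilon\le\eta$; agreement of two nets
there already determines the class. -/
lemma isNegligible_of_eventually_eq {z w : Eps → ℂ} {η : Eps} (h : ∀ ε ≤ η, z ε = w ε) :
    IsNegligible absFamily (z - w) := by
  refine isNegligible_num.2 fun q => (isOrd_zero q).congr' ?_ EventuallyEq.rfl
  have : ∀ᶠ ε : Eps in epsZero, ε < η :=
    tendsto_comap.eventually (eventually_lt_nhds (b := (η : ℝ)) η.2.1)
  filter_upwards [this] with ε hε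
  simp [h ε hε.le]

end Represents

/-! ### Continuous functionals defined by moderate nets of continuous functions -/

section Pairing

open MeasureTheory

variable {n : ℕ} {Ω : Opens (Rn n)}

lemma CptIn.image_preimage (K : CptIn Ω) :
    (Subtype.val : Ω → Rn n) '' (Subtype.val ⁻¹' K.1) = K.1 :=
  Set.image_preimage_eq_of_subset fun x hx => ⟨⟨x, K.2.2 hx⟩, rfl⟩

/-- A compact subset of `Ω`, as a compact set of points of the subtype. -/
def CptIn.compacts (K : CptIn Ω) : Compacts Ω :=
  ⟨Subtype.val ⁻¹' K.1, by
    rw [Subtype.isCompact_iff]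
    exact K.image_preimage.symm ▸ K.2.1⟩

lemma norm_le_contSemi (f : C(Ω, ℂ)) {K : Compacts Ω} {x : Ω} (hx : x ∈ K) :
    ‖f x‖ ≤ contSemi Ω K f :=
  ContinuousMap.norm_coe_le_norm (f.restrict (K : Set Ω)) ⟨x, hx⟩

lemma contSemi_le (f : C(Ω, ℂ)) (K : Compacts Ω) {c : ℝ} (hc : 0 ≤ c) (h : ∀ x ∈ K, ‖f x‖ ≤ c) :
    contSemi Ω K f ≤ c :=
  (ContinuousMap.norm_le (f.restrict (K : Set Ω)) hc).2 fun x => h x x.2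

lemma norm_le_psemi_zero (K : CptIn Ω) (f : Smooth Ω) {x : Rn n} (hx : x ∈ K.1) :
    ‖f x‖ ≤ psemi Ω (K, 0) f := by
  have := le_psemi K f (α := 0) (j := 0) (by simp) hx
  rwa [der_zero] at this

/-- The part of a compact set outside the interior of another one. -/
def CptIn.diffInterior (M L : CptIn Ω) : CptIn Ω :=
  ⟨M.1 \ interior L.1, M.2.1.diff isOpen_interior, Set.sdiff_subset.trans M.2.2⟩

/-- Lebesgue measure on `Ω`. -/
noncomputable abbrev volOn (Ω : Opens (Rn n)) : Measure Ω := volume.comap Subtype.val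

lemma volOn_preimage_lt_top (K : CptIn Ω) : volOn Ω (Subtype.val ⁻¹' K.1) < ⊤ := by
  have h : MeasurableEmbedding (Subtype.val : Ω → Rn n) :=
    MeasurableEmbedding.subtype_coe Ω.isOpen.measurableSet
  rw [volOn, h.comap_apply, K.image_preimage]
  exact K.2.1.measure_lt_top

lemma measurableSet_preimage (K : CptIn Ω) : MeasurableSet (Subtype.val ⁻¹' K.1 : Set Ω) :=
  measurable_subtype_coe K.2.1.measurableSet

/-- The support $M$ of $g$ is cut along $L$. On $L$ only the size of $f$ on $L$ enters; the size of
$f$ on the uncontrolled set $M$ is multiplied by $g$ outside the interior of $L$, which will be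
negligible. -/
lemma norm_mul_le_indicator (f : C(Ω, ℂ)) (g : 𝓓(Ω, ℂ)) (L M : CptIn Ω) (hM : tsupport g ⊆ M.1)
    (x : Ω) : ‖f x * g x‖ ≤
      (Subtype.val ⁻¹' L.1 : Set Ω).indicator
        (fun _ => contSemi Ω L.compacts f * psemi Ω (L, 0) (ofTest g)) x +
      (Subtype.val ⁻¹' M.1 : Set Ω).indicator
        (fun _ => contSemi Ω M.compacts f * psemi Ω (M.diffInterior L, 0) (ofTest g)) x := by
  have h1 : 0 ≤ contSemi Ω L.compacts f * psemi Ω (L, 0) (ofTest g) :=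
    mul_nonneg (apply_nonneg _ _) (apply_nonneg _ _)
  have h2 : 0 ≤ contSemi Ω M.compacts f * psemi Ω (M.diffInterior L, 0) (ofTest g) :=
    mul_nonneg (apply_nonneg _ _) (apply_nonneg _ _)
  rw [norm_mul]
  by_cases hL : x.1 ∈ L.1
  · refine le_add_of_le_of_nonneg ?_ (Set.indicator_nonneg (fun _ _ => h2) _)
    rw [Set.indicator_of_mem (show x ∈ Subtype.val ⁻¹' L.1 from hL)]
    exact mul_le_mul (norm_le_contSemi f hL) (norm_le_psemi_zero L (ofTest g) hL)
      (norm_nonneg _) (apply_nonneg _ _)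
  · refine le_add_of_nonneg_of_le (Set.indicator_nonneg (fun _ _ => h1) _) ?_
    by_cases hx : x.1 ∈ M.1
    · rw [Set.indicator_of_mem (show x ∈ Subtype.val ⁻¹' M.1 from hx)]
      exact mul_le_mul (norm_le_contSemi f hx) (norm_le_psemi_zero (M.diffInterior L) (ofTest g)
        ⟨hx, fun h => hL (interior_subset h)⟩) (norm_nonneg _) (apply_nonneg _ _)
    · rw [image_eq_zero_of_notMem_tsupport fun h => hx (hM h), norm_zero, mul_zero]
      exact Set.indicator_nonneg (fun _ _ => h2) _

lemma integrable_indicator_const (K : CptIn Ω) (c : ℝ) :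
    Integrable ((Subtype.val ⁻¹' K.1 : Set Ω).indicator (fun _ => c)) (volOn Ω) :=
  (integrable_indicator_iff (measurableSet_preimage K)).2
    (integrableOn_const (volOn_preimage_lt_top K).ne)

lemma integrable_mul (f : C(Ω, ℂ)) (g : 𝓓(Ω, ℂ)) :
    Integrable (fun x : Ω => f x * g x) (volOn Ω) := by
  let M : CptIn Ω := ⟨tsupport g, g.hasCompactSupport, g.tsupport_subset⟩
  exact Integrable.mono'
    ((integrable_indicator_const M _).add (integrable_indicator_const M _))
    (f.continuous.mul (g.continuous.comp continuous_subtype_val)).aestronglyMeasurable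
    (Eventually.of_forall (norm_mul_le_indicator f g M M Set.Subset.rfl))

/-- The integral of the product of a continuous function and a test function. -/
noncomputable def pairing (f : C(Ω, ℂ)) : 𝓓(Ω, ℂ) →ₗ[ℂ] ℂ where
  toFun g := ∫ x : Ω, f x * g x ∂(volOn Ω)
  map_add' g h := by
    rw [← integral_add (integrable_mul f g) (integrable_mul f h)]
    simp [mul_add]
  map_smul' c g := by
    rw [RingHom.id_apply, smul_eq_mul, ← integral_const_mul]
    refine integral_congr_ae (Eventually.of_forall fun x => ?_)
    change f x * (c * g x) = _
    ring

lemma norm_pairing_le (L M : CptIn Ω) : ∃ C : ℝ, 0 ≤ C ∧ ∀ (f : C(Ω, ℂ)) (g : 𝓓(Ω, ℂ)),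
    tsupport g ⊆ M.1 → ‖pairing f g‖ ≤
      C * (contSemi Ω L.compacts f * psemi Ω (L, 0) (ofTest g) +
        contSemi Ω M.compacts f * psemi Ω (M.diffInterior L, 0) (ofTest g)) := by
  set a := (volOn Ω).real (Subtype.val ⁻¹' L.1)
  set b := (volOn Ω).real (Subtype.val ⁻¹' M.1)
  have ha : 0 ≤ a := measureReal_nonneg
  have hb : 0 ≤ b := measureReal_nonneg
  refine ⟨a + b, by positivity, fun f g hM => ?_⟩
  refine (norm_integral_le_of_norm_le
    ((integrable_indicator_const L _).add (integrable_indicator_const M _))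
    (Eventually.of_forall (norm_mul_le_indicator f g L M hM))).trans ?_
  simp only [Pi.add_apply]
  rw [integral_add (integrable_indicator_const L _) (integrable_indicator_const M _),
    integral_indicator (measurableSet_preimage L),
    integral_indicator (measurableSet_preimage M), setIntegral_const, setIntegral_const,
    smul_eq_mul, smul_eq_mul]
  have h1 : 0 ≤ contSemi Ω L.compacts f * psemi Ω (L, 0) (ofTest g) :=
    mul_nonneg (apply_nonneg _ _) (apply_nonneg _ _)
  have h2 : 0 ≤ contSemi Ω M.compacts f * psemi Ω (M.diffInterior L, 0) (ofTest g) :=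
    mul_nonneg (apply_nonneg _ _) (apply_nonneg _ _)
  nlinarith [mul_nonneg ha h2, mul_nonneg hb h1]

/-- The exponent $N$ comes from $f$ on $L$ and is fixed before the net $u$. The supports of $u$ lie
in some $M$ on which $f$ may grow with a worse exponent, but $u$ is negligible on $M$ minus the
interior of $L$, and this outweighs any power. -/
lemma isOrd_pairing {f : Eps → C(Ω, ℂ)} (hf : IsModerate (contSemi Ω) f) (L : CptIn Ω) :
    ∃ N : ℕ, ∀ u : cptNets Ω, gsupp (cls u).incl ⊆ interior L.1 → ∀ b : ℝ,
      IsOrd (fun ε => psemi Ω (L, 0) (ofTest (u.1 ε))) b →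
        IsOrd (fun ε => ‖pairing (f ε) (u.1 ε)‖) (b - N) := by
  obtain ⟨N, hN⟩ := hf L.compacts
  refine ⟨N, fun u hu b hb => ?_⟩
  obtain ⟨M, hM⟩ := u.2.1
  obtain ⟨N', hN'⟩ := hf M.compacts
  obtain ⟨C, -, hC⟩ := norm_pairing_le L M
  have hdisj : Disjoint (M.diffInterior L).1 (gsupp (cls u).incl) :=
    Set.disjoint_left.2 fun x hx hxu => hx.2 (hu hxu)
  -- This order of smallness away from $L$ compensates the growth $\varepsilon^{-N'}$ of $f$ on $M$.
  obtain ⟨q, hq⟩ := exists_nat_ge (b - N + N')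
  have h1 := hN.mul hb
  have h2 := hN'.mul ((negligible_off_gsupp u.2.2 _ hdisj 0 q).mono hq)
  have h3 : IsOrd _ (b - N) := IsOrd.add (by convert h1 using 1; ring) (by convert h2 using 1; ring)
  refine h3.of_le (C := C) fun ε => ?_
  rw [abs_of_nonneg (norm_nonneg _), abs_of_nonneg (add_nonneg
    (mul_nonneg (apply_nonneg _ _) (apply_nonneg _ _))
    (mul_nonneg (apply_nonneg _ _) (apply_nonneg _ _)))]
  exact hC _ _ (hM ε)

lemma exists_cptIn_superset (K : CptIn Ω) : ∃ L : CptIn Ω, K.1 ⊆ interior L.1 := by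
  obtain ⟨L, hL, hKL, hLΩ⟩ := exists_compact_between K.2.1 Ω.isOpen K.2.2
  exact ⟨⟨L, hL, hLΩ⟩, hKL⟩

lemma exists_gsupp_subset_interior (w : Gc Ω) : ∃ L : CptIn Ω, gsupp w.incl ⊆ interior L.1 := by
  obtain ⟨K, hK⟩ := w.2
  obtain ⟨L, hL⟩ := exists_cptIn_superset K
  exact ⟨L, hK.trans hL⟩

lemma isModerate_pairing {f : Eps → C(Ω, ℂ)} (hf : IsModerate (contSemi Ω) f) (u : cptNets Ω) :
    IsModerate absFamily fun ε => pairing (f ε) (u.1 ε) := by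
  obtain ⟨L, hL⟩ := exists_gsupp_subset_interior (cls u)
  obtain ⟨N, hN⟩ := isOrd_pairing hf L
  obtain ⟨N', hN'⟩ := u.2.2 (L, 0)
  refine isModerate_num.2 ⟨N + N', ?_⟩
  convert hN u hL _ hN' using 1
  push_cast
  ring

lemma mk_pairing_congr {f : Eps → C(Ω, ℂ)} (hf : IsModerate (contSemi Ω) f) {u v : cptNets Ω}
    (huv : cls u = cls v) :
    CTilde.mk _ (isModerate_pairing hf u) = CTilde.mk _ (isModerate_pairing hf v) := by
  refine CTilde.mk_eq_mk.2 (isNegligible_num.2 fun q => ?_)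
  have h0 : cls (u - v) = 0 := by
    have : cls (u - v) = cls u - cls v := rfl
    rw [this, huv, sub_self]
  obtain ⟨L, hL⟩ := exists_gsupp_subset_interior (cls (u - v))
  obtain ⟨N, hN⟩ := isOrd_pairing hf L
  have h1 : IsNegligible (psemi Ω) fun ε => ofTest ((u - v).1 ε) :=
    GE.mk_eq_zero.1 (congrArg Gc.incl h0)
  -- Well-definedness: the difference of the representatives is negligible, and order $q+N$ for it
  -- leaves order $q$ after the loss of $N$.
  convert hN (u - v) hL _ (h1 (L, 0) (q + N)) using 1
  · ext ε
    have : (u - v).1 ε = u.1 ε - v.1 ε := rfl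
    rw [this, map_sub]
    rfl
  · push_cast
    ring

/-- The functional defined by a moderate net of continuous functions. -/
noncomputable def intFun (f : Eps → C(Ω, ℂ)) (hf : IsModerate (contSemi Ω) f) :
    Gc Ω →ₗ[CTilde] CTilde where
  toFun w := CTilde.mk _ (isModerate_pairing hf (cls_surjective w).choose)
  map_add' w w' := by
    rw [mk_pairing_congr hf (v := (cls_surjective w).choose + (cls_surjective w').choose) (by
      rw [(cls_surjective (w + w')).choose_spec, cls_add, (cls_surjective w).choose_spec,
        (cls_surjective w').choose_spec]), ← CTilde.mk_add]
    congr 1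
    ext ε
    exact map_add (pairing (f ε)) _ _
  map_smul' c w := by
    obtain ⟨z, hz, rfl⟩ := CTilde.ind c
    rw [mk_pairing_congr hf (v := (⟨z, hz⟩ : modNum) • (cls_surjective w).choose) (by
      rw [(cls_surjective _).choose_spec, cls_smul, (cls_surjective w).choose_spec]),
      RingHom.id_apply, smul_eq_mul, ← CTilde.mk_mul]
    congr 1
    ext ε
    exact map_smul (pairing (f ε)) (z ε) _

lemma intFun_cls (f : Eps → C(Ω, ℂ)) (hf : IsModerate (contSemi Ω) f) (u : cptNets Ω) :
    intFun f hf (cls u) = CTilde.mk _ (isModerate_pairing hf u) :=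
  mk_pairing_congr hf (cls_surjective (cls u)).choose_spec

lemma exists_le_val_intFun {f : Eps → C(Ω, ℂ)} (hf : IsModerate (contSemi Ω) f) (L : CptIn Ω) :
    ∃ N : ℕ, ∀ w : Gc Ω, gsupp w.incl ⊆ interior L.1 → ∀ b : ℝ,
      ((b + N : ℝ) : EReal) < GE.val (p := psemi Ω) (L, 0) w.incl →
        (b : EReal) ≤ (intFun f hf w).val := by
  obtain ⟨N, hN⟩ := isOrd_pairing hf L
  refine ⟨N, fun w hw b hb => ?_⟩
  obtain ⟨u, rfl⟩ := cls_surjective w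
  rw [intFun_cls, CTilde.val_mk]
  refine le_netVal_of_isOrd ?_
  convert hN u hw _ (isOrd_of_lt_netVal hb) using 1
  ring

lemma continuous_intFun_GK {f : Eps → C(Ω, ℂ)} (hf : IsModerate (contSemi Ω) f) (K : CptIn Ω) :
    @Continuous (GK K) CTilde (topGK {0} K) inferInstance fun w => intFun f hf w.1 := by
  let : TopologicalSpace (GK K) := topGK {0} K
  obtain ⟨L, hL⟩ := exists_cptIn_superset K
  obtain ⟨N, hN⟩ := exists_le_val_intFun hf L
  refine continuous_iff_continuousAt.2 fun w => ?_
  refine (CTilde.hasBasis_nhds _).tendsto_right_iff.2 fun b _ => ?_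
  -- The ball of radius $e^{-(b+N)}$ for the order-zero seminorm on $L$ suffices, since pairing with
  -- $f$ lowers the valuation by at most $N$.
  refine mem_of_superset (IsOpen.mem_nhds (isOpen_generateFrom_of_mem
    ⟨(⟨L, hL⟩, ⟨0, rfl⟩), w, EReal.exp ((-(b + N) : ℝ) : EReal), ?_, rfl⟩) ?_) ?_
  · rw [EReal.exp_coe]
    exact ENNReal.ofReal_pos.2 (Real.exp_pos _)
  · change GE.ups _ (w - w).1.incl < _
    have h0 : (w - w).1.incl = GE.mk (p := psemi Ω) 0 (isModerate_zero _) := by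
      rw [sub_self]
      rfl
    rw [h0, GE.ups, EReal.exp_lt_exp_iff, EReal.coe_neg, EReal.neg_lt_neg_iff]
    refine (EReal.coe_lt_coe_iff.2 (lt_add_one _)).trans_le (le_netVal_of_isOrd ?_)
    simpa using isOrd_zero _
  · intro v hv
    change GE.ups _ (v - w).1.incl < _ at hv
    rw [GE.ups, EReal.exp_lt_exp_iff, EReal.coe_neg, EReal.neg_lt_neg_iff] at hv
    change (b : EReal) ≤ (intFun f hf v.1 - intFun f hf w.1).val
    rw [← map_sub]
    exact hN (v - w).1 ((v - w).2.trans hL) b hv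

/-- The functional defined by a moderate net of continuous functions, as a continuous functional
on `𝒢_c^0(Ω)`. -/
noncomputable def intFunCLM (f : Eps → C(Ω, ℂ)) (hf : IsModerate (contSemi Ω) f) :
    GcOrd 0 Ω →L[CTilde] CTilde where
  toLinearMap := (intFun f hf).comp (GcOrd.equiv (m := 0)).symm.toLinearMap
  -- The limit topology is the infimum of all admissible topologies, and the one induced by the
  -- functional is admissible.
  cont := continuous_iff_le_induced.2 (sInf_le ⟨isLocallyConvex_induced _, fun K =>
    continuous_induced_rng.2 (continuous_intFun_GK hf K)⟩)

lemma isDefinedBy_intFunCLM (f : Eps → C(Ω, ℂ)) (hf : IsModerate (contSemi Ω) f) :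
    IsDefinedBy (onGc (intFunCLM f hf)) f :=
  fun u => ⟨isModerate_pairing hf u, (intFun_cls f hf u).symm⟩

end Pairing

/-! ### Test functions as iterated integrals of their mixed derivative -/

section Primitive

open MeasureTheory

/-- The partial derivative `∂_i` of a function on `Fin n → ℝ`. -/
noncomputable def piPd {n : ℕ} (i : Fin n) (h : (Fin n → ℝ) → ℂ) : (Fin n → ℝ) → ℂ :=
  fun x => fderiv ℝ h x (Pi.single i 1)

/-- Iterated partial derivatives of a function on `Fin n → ℝ`. -/
noncomputable def piPds {n : ℕ} (l : List (Fin n)) (h : (Fin n → ℝ) → ℂ) : (Fin n → ℝ) → ℂ :=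
  l.foldr piPd h

lemma contDiff_piPd {n : ℕ} (i : Fin n) {h : (Fin n → ℝ) → ℂ} (hh : ContDiff ℝ ∞ h) :
    ContDiff ℝ ∞ (piPd i h) :=
  (hh.fderiv_right (by simp)).clm_apply contDiff_const

lemma hasCompactSupport_piPd {n : ℕ} (i : Fin n) {h : (Fin n → ℝ) → ℂ}
    (hh : HasCompactSupport h) : HasCompactSupport (piPd i h) :=
  (hh.fderiv (𝕜 := ℝ)).comp_left (g := fun A : (Fin n → ℝ) →L[ℝ] ℂ => A (Pi.single i 1)) rfl

lemma contDiff_piPds {n : ℕ} (l : List (Fin n)) {h : (Fin n → ℝ) → ℂ} (hh : ContDiff ℝ ∞ h) :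
    ContDiff ℝ ∞ (piPds l h) := by
  induction l with
  | nil => exact hh
  | cons a l ih => exact contDiff_piPd a ih

lemma hasCompactSupport_piPds {n : ℕ} (l : List (Fin n)) {h : (Fin n → ℝ) → ℂ}
    (hh : HasCompactSupport h) : HasCompactSupport (piPds l h) := by
  induction l with
  | nil => exact hh
  | cons a l ih => exact hasCompactSupport_piPd a ih

lemma hasFDerivAt_cons {n : ℕ} (t : ℝ) (x : Fin n → ℝ) :
    HasFDerivAt (fun x : Fin n → ℝ => (Fin.cons t x : Fin (n + 1) → ℝ))
      (ContinuousLinearMap.pi fun i : Fin (n + 1) => Fin.cases (motive := fun _ =>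
        (Fin n → ℝ) →L[ℝ] ℝ) 0 (fun i => ContinuousLinearMap.proj i) i) x := by
  refine hasFDerivAt_pi.2 fun i => ?_
  refine Fin.cases ?_ (fun i => ?_) i
  · exact hasFDerivAt_const t x
  · exact hasFDerivAt_apply i x

lemma contDiff_cons {n : ℕ} (t : ℝ) :
    ContDiff ℝ ∞ (fun x : Fin n → ℝ => (Fin.cons t x : Fin (n + 1) → ℝ)) := by
  refine contDiff_pi.2 fun i => ?_
  refine Fin.cases contDiff_const (fun i => ?_) i
  exact contDiff_apply ℝ ℝ i

lemma isClosedEmbedding_cons {n : ℕ} (t : ℝ) :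
    IsClosedEmbedding (fun x : Fin n → ℝ => (Fin.cons t x : Fin (n + 1) → ℝ)) :=
  Function.LeftInverse.isClosedEmbedding (f := fun z i => z i.succ) (fun _ => rfl)
    (continuous_pi fun _ => continuous_apply _) (contDiff_cons t).continuous

/-- Freezing the first coordinate commutes with differentiating in the others; this is what lets the
induction on the dimension act on slices. -/
lemma piPds_cons {n : ℕ} (l : List (Fin n)) {h : (Fin (n + 1) → ℝ) → ℂ} (hh : ContDiff ℝ ∞ h)
    (t : ℝ) : piPds l (fun x => h (Fin.cons t x)) =
      fun x => piPds (l.map Fin.succ) h (Fin.cons t x) := by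
  induction l with
  | nil => rfl
  | cons a l ih =>
    change piPd a (piPds l _) = fun x => piPd a.succ (piPds (l.map Fin.succ) h) (Fin.cons t x)
    rw [ih]
    ext x
    have h1 := ((contDiff_piPds (l.map Fin.succ) hh).differentiable (by simp)
      (Fin.cons t x)).hasFDerivAt.comp x (hasFDerivAt_cons t x)
    change fderiv ℝ _ x _ = fderiv ℝ _ _ _
    rw [show (fun x => piPds (l.map Fin.succ) h (Fin.cons t x)) =
      (piPds (l.map Fin.succ) h) ∘ fun x => Fin.cons t x from rfl, h1.fderiv]
    rw [ContinuousLinearMap.comp_apply]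
    congr 1
    ext i
    refine Fin.cases ?_ (fun i => ?_) i
    · simp
    · simp [Pi.single_apply]

lemma integral_piPd_zero {n : ℕ} {h : (Fin (n + 1) → ℝ) → ℂ} (hh : ContDiff ℝ ∞ h)
    (hc : HasCompactSupport h) (y : ℝ) (x : Fin n → ℝ) :
    ∫ t in Set.Iic y, piPd 0 h (Fin.cons t x) = h (Fin.cons y x) := by
  have hd : ∀ t : ℝ, HasDerivAt (fun t : ℝ => (Fin.cons t x : Fin (n + 1) → ℝ)) (Pi.single 0 1) t := by
    intro t
    refine hasDerivAt_pi.2 fun i => ?_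
    refine Fin.cases ?_ (fun i => ?_) i
    · simpa using hasDerivAt_id' t
    · simpa using hasDerivAt_const t (x i)
  have hd' : ∀ t : ℝ, HasDerivAt (fun t => h (Fin.cons t x)) (piPd 0 h (Fin.cons t x)) t := fun t =>
    (hh.differentiable (by simp) (Fin.cons t x)).hasFDerivAt.comp_hasDerivAt t (hd t)
  have hcont : ContDiff ℝ ∞ fun t : ℝ => (Fin.cons t x : Fin (n + 1) → ℝ) := by
    refine contDiff_pi.2 fun i => ?_
    exact Fin.cases contDiff_id (fun i => contDiff_const) i
  have hemb : IsClosedEmbedding fun t : ℝ => (Fin.cons t x : Fin (n + 1) → ℝ) :=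
    Function.LeftInverse.isClosedEmbedding (f := fun z => z 0) (fun _ => rfl)
      (by fun_prop) hcont.continuous
  have := (hc.comp_isClosedEmbedding hemb).integral_Iic_deriv_eq
    ((hh.comp hcont).of_le (by simp)) y
  refine Eq.trans ?_ this
  refine integral_congr_ae (Eventually.of_forall fun t => ?_)
  exact (hd' t).deriv.symm

/-- A test function is the primitive, in all the variables, of its mixed derivative. -/
lemma setIntegral_Iic_piPds {n : ℕ} {h : (Fin n → ℝ) → ℂ} (hh : ContDiff ℝ ∞ h)
    (hc : HasCompactSupport h) (y : Fin n → ℝ) :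
    ∫ x in Set.Iic y, piPds (List.finRange n) h x = h y := by
  induction n with
  | zero =>
    have hs : Set.Iic y = Set.univ := Set.eq_univ_of_forall fun x i => i.elim0
    -- In dimension zero Lebesgue measure is the unit mass at the only point.
    rw [hs, setIntegral_univ, volume_pi, Measure.pi_of_empty (x := y), integral_dirac]
    simp [piPds]
  | succ n ih =>
    set H := piPds ((List.finRange n).map Fin.succ) h
    have hH : ContDiff ℝ ∞ H := contDiff_piPds _ hh
    have hHc : HasCompactSupport H := hasCompactSupport_piPds _ hc
    -- The derivative in the first variable is the outermost one, so it is the one undone by the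
    -- inner integral below.
    have hD : piPds (List.finRange (n + 1)) h = piPd 0 H := by
      rw [List.finRange_succ]
      rfl
    have hint : Integrable (piPd 0 H) :=
      (contDiff_piPd 0 hH).continuous.integrable_of_hasCompactSupport (hasCompactSupport_piPd 0 hHc)
    set e := (MeasurableEquiv.piFinSuccAbove (fun _ : Fin (n + 1) => ℝ) 0).symm
    have he : MeasurePreserving e :=
      (volume_preserving_piFinSuccAbove (fun _ : Fin (n + 1) => ℝ) 0).symm _
    have hcons : ∀ p : ℝ × (Fin n → ℝ), e p = Fin.cons p.1 p.2 := fun p => by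
      simp [e, MeasurableEquiv.piFinSuccAbove, Fin.insertNthEquiv]
    have hpre : e ⁻¹' Set.Iic y = Set.Iic (y 0) ×ˢ Set.Iic (Fin.tail y) := by
      ext p
      rw [Set.mem_preimage, hcons, Set.mem_Iic, Set.mem_prod, Set.mem_Iic, Set.mem_Iic]
      exact Fin.cons_le
    rw [hD, ← he.setIntegral_preimage_emb e.measurableEmbedding, hpre,
      Measure.volume_eq_prod, ← Measure.prod_restrict, integral_prod_symm]
    -- With the first coordinate integrated innermost, the fundamental theorem of calculus leaves
    -- the slice at $y_0$, to which the induction hypothesis applies.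
    · calc _ = ∫ x in Set.Iic (Fin.tail y), H (Fin.cons (y 0) x) := by
            refine integral_congr_ae (Eventually.of_forall fun x => ?_)
            simp only [hcons]
            exact integral_piPd_zero hH hHc (y 0) x
        _ = _ := by
            have h1 := ih (hh.comp (contDiff_cons (y 0)))
              (hc.comp_isClosedEmbedding (isClosedEmbedding_cons (y 0))) (Fin.tail y)
            rw [show h ∘ (fun x : Fin n → ℝ => (Fin.cons (y 0) x : Fin (n + 1) → ℝ)) =
              fun x => h (Fin.cons (y 0) x) from rfl, piPds_cons _ hh] at h1
            exact h1.trans (congrArg h (Fin.cons_self_tail y))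
    · rw [Measure.prod_restrict]
      exact ((he.integrable_comp_emb e.measurableEmbedding).2 hint).integrableOn

end Primitive

/-! ### Bounding a supported function by one of its derivatives -/

section Derivatives

variable {n : ℕ} {Ω : Opens (Rn n)}

lemma multiIdx_induction {P : (Fin n → ℕ) → Prop} (h0 : P 0)
    (h1 : ∀ α i, P α → P (α + Pi.single i 1)) (α : Fin n → ℕ) : P α := by
  induction hk : ∑ i, α i generalizing α with
  | zero =>
    have : α = 0 := funext fun i => (Finset.sum_eq_zero_iff.1 hk) i (Finset.mem_univ i)
    exact this ▸ h0
  | succ k ih =>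
    obtain ⟨i, -, hi⟩ := Finset.exists_ne_zero_of_sum_ne_zero (hk.trans_ne k.succ_ne_zero)
    have hα : α = (α - Pi.single i 1) + Pi.single i 1 := by
      refine (tsub_add_cancel_of_le fun j => ?_).symm
      rcases eq_or_ne j i with rfl | hj
      · simpa using Nat.one_le_iff_ne_zero.2 hi
      · simp [hj]
    rw [hα]
    refine h1 _ _ (ih _ ?_)
    rw [hα] at hk
    simpa [Finset.sum_add_distrib] using hk

lemma der_add (α β : Fin n → ℕ) :
    (der (α + β) : Module.End ℂ (Smooth Ω)) = der α * der β := by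
  induction β using multiIdx_induction with
  | h0 => simp [der_zero]
  | h1 β i ih => rw [← add_assoc, der_add_single, ih, der_add_single, mul_assoc]

lemma tsupport_der_subset (α : Fin n → ℕ) (f : Smooth Ω) :
    tsupport (der α f) ⊆ tsupport f := by
  refine closure_minimal (fun x hx => ?_) (isClosed_tsupport _)
  by_contra hxf
  have hxΩ : x ∈ Ω := by
    by_contra h
    exact hx ((der α f).2.2 x h)
  exact hx (der_eq_zero_of_eventuallyEq hxΩ (notMem_tsupport_iff_eventuallyEq.1 hxf) α)

/-- The derivative `∂^α` of a test function. -/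
noncomputable def derTest (α : Fin n → ℕ) (g : 𝓓(Ω, ℂ)) : 𝓓(Ω, ℂ) :=
  ⟨der α (ofTest g), by
    refine contDiff_iff_contDiffAt.2 fun x => ?_
    by_cases hx : x ∈ Ω
    · exact (der α (ofTest g)).contDiffAt hx
    · have hxg : x ∉ tsupport (der α (ofTest g)) := fun h =>
        hx (g.tsupport_subset (tsupport_der_subset α (ofTest g) h))
      exact contDiffAt_const.congr_of_eventuallyEq (notMem_tsupport_iff_eventuallyEq.1 hxg),
    g.hasCompactSupport.of_isClosed_subset (isClosed_tsupport _)
      (tsupport_der_subset α (ofTest g)),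
    (tsupport_der_subset α (ofTest g)).trans g.tsupport_subset⟩

/-- The derivative `∂^α` of a net of test functions. -/
noncomputable def derNet (α : Fin n → ℕ) (u : cptNets Ω) : cptNets Ω :=
  ⟨fun ε => derTest α (u.1 ε), by
    obtain ⟨K, hK⟩ := u.2.1
    refine ⟨⟨K, fun ε => (tsupport_der_subset α (ofTest (u.1 ε))).trans (hK ε)⟩, ?_⟩
    exact isModerate_map (q := psemi Ω) (A := der α) (fun k =>
      ⟨(k.1, k.2 + (psemi_der_le k.1 α).choose), (psemi_der_le k.1 α).choose_spec k.2⟩) u.2.2⟩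

lemma Smooth.contDiff (f : Smooth (⊤ : Opens (Rn n))) : ContDiff ℝ ∞ f :=
  contDiffOn_univ.1 f.2.1

/-- From any point of the ball, a segment of length $2R+1$ in direction $e_i$ ends outside it, where
$f$ vanishes; the mean value inequality along the segment gives the bound. The extra 1 makes the
exit strict and keeps the constant at least one, so that its powers increase with the exponent. -/
lemma norm_le_of_norm_pd_le {R c : ℝ} (hR : 0 ≤ R) (f : Smooth (⊤ : Opens (Rn n)))
    (hf : tsupport f ⊆ Metric.closedBall 0 R) (i : Fin n) (h : ∀ x, ‖pd i f x‖ ≤ c) (x : Rn n) :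
    ‖f x‖ ≤ (2 * R + 1) * c := by
  have hc : 0 ≤ c := (norm_nonneg _).trans (h x)
  have hzero : ∀ y : Rn n, R < ‖y‖ → f y = 0 := fun y hy =>
    image_eq_zero_of_notMem_tsupport fun hy' => by
      have := mem_closedBall_zero_iff.1 (hf hy')
      linarith
  by_cases hx : ‖x‖ ≤ R
  · let e : Rn n := EuclideanSpace.single i 1
    have he : ‖e‖ = 1 := by simp [e]
    have hd : ∀ s : ℝ, HasDerivAt (fun s : ℝ => f (x + s • e)) (pd i f (x + s • e)) s := by
      intro s
      rw [pd_apply i f (Opens.mem_top _)]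
      refine (f.differentiableAt (Opens.mem_top _)).hasFDerivAt.comp_hasDerivAt s ?_
      simpa using ((hasDerivAt_id' s).smul_const e).const_add x
    have := norm_image_sub_le_of_norm_deriv_le_segment' (a := 0) (b := 2 * R + 1) (C := c)
      (fun s _ => (hd s).hasDerivWithinAt) (fun s _ => h _) (2 * R + 1)
      ⟨by linarith, le_rfl⟩
    have h0 : f (x + (2 * R + 1) • e) = 0 := by
      refine hzero _ ?_
      have h1 := norm_sub_le (x + (2 * R + 1) • e) x
      rw [add_sub_cancel_left, norm_smul, he, Real.norm_of_nonneg (by linarith)] at h1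
      linarith
    rw [h0, zero_smul, add_zero, zero_sub, norm_neg, sub_zero] at this
    linarith
  · rw [hzero x (not_le.1 hx), norm_zero]
    positivity

lemma norm_le_of_norm_der_le {R : ℝ} (hR : 0 ≤ R) (α : Fin n → ℕ) {c : ℝ} :
    ∀ f : Smooth (⊤ : Opens (Rn n)), tsupport f ⊆ Metric.closedBall 0 R →
      (∀ x, ‖der α f x‖ ≤ c) → ∀ x, ‖f x‖ ≤ (2 * R + 1) ^ (∑ i, α i) * c := by
  induction α using multiIdx_induction with
  | h0 =>
    intro f _ h
    simpa [der_zero] using h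
  | h1 α i ih =>
    intro f hf h
    have hpd : tsupport (pd i f) ⊆ Metric.closedBall 0 R := by
      have := tsupport_der_subset (0 + Pi.single i 1) f
      rw [der_add_single, der_zero, one_mul] at this
      exact this.trans hf
    intro x
    rw [der_add_single] at h
    refine (norm_le_of_norm_pd_le hR f hf i (ih (pd i f) hpd h) x).trans_eq ?_
    simp only [Pi.add_apply, Finset.sum_add_distrib, Finset.sum_pi_single', Finset.mem_univ,
      if_true, pow_succ]
    ring

/-- Every $\beta$ with $|\beta|\le j$ lies coordinatewise below $(j,\dots,j)$, so $\partial^\beta f$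
can be differentiated further up to that single derivative and recovered from it with at most $nj$
uses of the one-variable bound. -/
lemma psemi_le_of_norm_der_le {R : ℝ} (hR : 0 ≤ R) (K : CptIn (⊤ : Opens (Rn n))) (j : ℕ) {c : ℝ}
    (f : Smooth (⊤ : Opens (Rn n))) (hf : tsupport f ⊆ Metric.closedBall 0 R)
    (h : ∀ x, ‖der (fun _ => j) f x‖ ≤ c) :
    psemi ⊤ (K, j) f ≤ (2 * R + 1) ^ (n * j) * c := by
  have hc : 0 ≤ c := (norm_nonneg _).trans (h 0)
  refine (psemi_le_iff _ _ _ (by positivity)).2 fun β hβ x _ => ?_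
  have hβj : β ≤ fun _ => j := fun i =>
    (Finset.single_le_sum (fun _ _ => Nat.zero_le _) (Finset.mem_univ i)).trans hβ
  have hder : ∀ x, ‖der ((fun _ => j) - β) (der β f) x‖ ≤ c := fun x => by
    rw [← Module.End.mul_apply, ← der_add, tsub_add_cancel_of_le hβj]
    exact h x
  refine (norm_le_of_norm_der_le hR _ (der β f) ((tsupport_der_subset β f).trans hf) hder
    x).trans ?_
  refine mul_le_mul_of_nonneg_right (pow_le_pow_right₀ (by linarith) ?_) hc
  refine (Finset.sum_le_sum (g := fun _ => j) fun i _ => Nat.sub_le _ _).trans_eq ?_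
  simp

/-- Carries the mixed derivative from Euclidean space to the plain product, where the integration
one coordinate at a time was done. -/
lemma der_one_toLp (f : Smooth (⊤ : Opens (Rn n))) (x : Fin n → ℝ) :
    der 1 f (WithLp.toLp 2 x) = piPds (List.finRange n) (fun x => f (WithLp.toLp 2 x)) x := by
  have hpd : ∀ (i : Fin n) (g : Smooth (⊤ : Opens (Rn n))),
      (fun x : Fin n → ℝ => pd i g (WithLp.toLp 2 x)) =
        piPd i fun x => g (WithLp.toLp 2 x) := by
    intro i g
    ext x
    have h1 := (g.differentiableAt (Opens.mem_top (WithLp.toLp 2 x))).hasFDerivAt.comp x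
      (PiLp.continuousLinearEquiv 2 ℝ fun _ : Fin n => ℝ).symm.hasFDerivAt
    rw [pd_apply i g (Opens.mem_top _), piPd]
    refine Eq.trans ?_ (congrArg (fun A => A (Pi.single i 1)) h1.fderiv.symm)
    rfl
  have key : ∀ l : List (Fin n), (fun x : Fin n → ℝ =>
      (l.map fun i => (pd i : Module.End ℂ (Smooth (⊤ : Opens (Rn n)))) ^ (1 : Fin n → ℕ) i).prod f
        (WithLp.toLp 2 x)) = piPds l fun x => f (WithLp.toLp 2 x) := by
    intro l
    induction l with
    | nil => rfl
    | cons a l ih =>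
      simp only [List.map_cons, List.prod_cons, Module.End.mul_apply, Pi.one_apply, pow_one] at *
      rw [hpd, ih]
      rfl
  exact congrFun (key (List.finRange n)) x

/-- The points all of whose coordinates are at most those of `y`. -/
def orthant (y : Rn n) : Set (Rn n) := {x | ∀ i, x i ≤ y i}

open MeasureTheory

lemma setIntegral_orthant_der_one (f : Smooth (⊤ : Opens (Rn n))) (hf : HasCompactSupport f)
    (y : Rn n) : ∫ x in orthant y, der 1 f x = f y := by
  let e := PiLp.continuousLinearEquiv 2 ℝ fun _ : Fin n => ℝ
  have hp : MeasurePreserving (MeasurableEquiv.toLp 2 (Fin n → ℝ)) :=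
    PiLp.volume_preserving_toLp (Fin n)
  have h := setIntegral_Iic_piPds (h := fun x => f (WithLp.toLp 2 x))
    (f.contDiff.comp e.symm.contDiff) (hf.comp_homeomorph e.symm.toHomeomorph) (y.ofLp)
  rw [← hp.setIntegral_preimage_emb (MeasurableEquiv.measurableEmbedding _)]
  refine Eq.trans ?_ h
  refine integral_congr_ae (Eventually.of_forall fun x => ?_)
  exact der_one_toLp f x

end Derivatives

/-! ### The local structure theorem with uniform constants -/

section Structure

open MeasureTheory

/-- A linear functional bounded by the norm of a linear map into a Hilbert space is given by the
inner product with a vector. -/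
lemma exists_inner_eq_of_norm_le {V H : Type*} [AddCommGroup V] [Module ℂ V]
    [NormedAddCommGroup H] [InnerProductSpace ℂ H] [CompleteSpace H] (A : V →ₗ[ℂ] H)
    (t : V →ₗ[ℂ] ℂ) {M : ℝ} (hM : 0 ≤ M) (h : ∀ v, ‖t v‖ ≤ M * ‖A v‖) :
    ∃ g : H, ‖g‖ ≤ M ∧ ∀ v, t v = inner ℂ g (A v) := by
  have hker : LinearMap.ker A ≤ LinearMap.ker t := fun v hv => by
    have := h v
    rw [LinearMap.mem_ker.1 hv, norm_zero, mul_zero] at this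
    exact norm_le_zero_iff.1 this
  let s : LinearMap.range A →ₗ[ℂ] ℂ :=
    (LinearMap.ker A).liftQ t hker ∘ₗ A.quotKerEquivRange.symm.toLinearMap
  have hs : ∀ v, s ⟨A v, LinearMap.mem_range_self A v⟩ = t v := fun v => by
    have : A.quotKerEquivRange.symm ⟨A v, LinearMap.mem_range_self A v⟩ =
        (LinearMap.ker A).mkQ v := A.quotKerEquivRange_symm_apply_image v _
    simp only [s, LinearMap.comp_apply, LinearEquiv.coe_coe, this]
    rfl
  have hsM : ∀ w, ‖s w‖ ≤ M * ‖w‖ := by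
    rintro ⟨_, v, rfl⟩
    rw [hs]
    exact h v
  -- The range need not be closed; the norm-preserving extension to all of $H$ brings Riesz into
  -- play and keeps the bound $M$.
  obtain ⟨s', hs', hn⟩ := exists_extension_norm_eq (LinearMap.range A) (s.mkContinuous M hsM)
  refine ⟨(InnerProductSpace.toDual ℂ H).symm s', ?_, fun v => ?_⟩
  · rw [LinearIsometryEquiv.norm_map, hn]
    exact s.mkContinuous_norm_le hM hsM
  · rw [InnerProductSpace.toDual_symm_apply, ← hs v]
    exact (hs' ⟨A v, LinearMap.mem_range_self A v⟩).symm

/-- Cauchy–Schwarz against the constant function 1. -/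
lemma integral_norm_le_mul_norm_Lp {α : Type*} [MeasurableSpace α] (μ : Measure α)
    [IsFiniteMeasure μ] (h : Lp ℂ 2 μ) :
    ∫ x, ‖h x‖ ∂μ ≤ (μ Set.univ ^ (1 / 2 : ℝ)).toReal * ‖h‖ := by
  have h1 := eLpNorm_le_eLpNorm_mul_rpow_measure_univ (p := 1) (q := 2) (μ := μ)
    (by norm_num) (Lp.aestronglyMeasurable h)
  have h2 := ENNReal.toReal_mono (ENNReal.mul_ne_top (Lp.eLpNorm_ne_top h)
    (ENNReal.rpow_ne_top_of_nonneg (by norm_num) (measure_ne_top μ _))) h1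
  rw [ENNReal.toReal_mul, ← Lp.norm_def, mul_comm] at h2
  norm_num at h2 ⊢
  rwa [integral_norm_eq_lintegral_enorm (Lp.aestronglyMeasurable h), ← eLpNorm_one_eq_lintegral_enorm]

variable {n : ℕ} {Ω : Opens (Rn n)}

lemma isClosed_orthant_rel : IsClosed {p : Rn n × Rn n | p.2 ∈ orthant p.1} := by
  have : {p : Rn n × Rn n | p.2 ∈ orthant p.1} = ⋂ i, {p | p.2 i ≤ p.1 i} := by
    ext p
    simp [orthant]
  rw [this]
  exact isClosed_iInter fun i => isClosed_le (by fun_prop) (by fun_prop)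

lemma measurableSet_orthant (y : Rn n) : MeasurableSet (orthant y) :=
  (isClosed_orthant_rel.preimage (f := fun x => (y, x)) (by fun_prop)).measurableSet

lemma measurableSet_setOf_mem_orthant (x : Rn n) : MeasurableSet {y | x ∈ orthant y} :=
  (isClosed_orthant_rel.preimage (f := fun y => (y, x)) (by fun_prop)).measurableSet

lemma volume_hyperplane (i : Fin n) (c : ℝ) : volume {y : Rn n | y i = c} = 0 := by
  have hp : MeasurePreserving (MeasurableEquiv.toLp 2 (Fin n → ℝ)) :=
    PiLp.volume_preserving_toLp (Fin n)
  rw [← hp.measure_preimage_equiv]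
  exact Measure.pi_hyperplane (fun _ : Fin n => (volume : Measure ℝ)) i c

/-- The integrals of an integrable function over the opposite orthants are continuous. -/
lemma continuous_setIntegral_orthant {μ : Measure (Rn n)} (hμ : μ ≪ volume) {g : Rn n → ℂ}
    (hg : Integrable g μ) : Continuous fun x => ∫ y in {y | x ∈ orthant y}, g y ∂μ := by
  have hrw : (fun x => ∫ y in {y | x ∈ orthant y}, g y ∂μ) =
      fun x => ∫ y, {y | x ∈ orthant y}.indicator g y ∂μ := by
    ext x
    rw [integral_indicator (measurableSet_setOf_mem_orthant x)]
  rw [hrw]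
  refine continuous_iff_continuousAt.2 fun x₀ => ?_
  refine continuousAt_of_dominated (bound := fun y => ‖g y‖) (Eventually.of_forall fun x =>
    hg.aestronglyMeasurable.indicator (measurableSet_setOf_mem_orthant x))
    (Eventually.of_forall fun x => Eventually.of_forall fun y => norm_indicator_le_norm_self _ _)
    hg.norm ?_
  -- For fixed $y$, the indicator of $x\le y$ is locally constant near $x_0$ unless some coordinate
  -- of $y$ equals that of $x_0$; these exceptional $y$ fill finitely many hyperplanes, which are
  -- null.
  have hne : ∀ᵐ y ∂μ, ∀ i, y i ≠ x₀ i := by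
    refine ae_all_iff.2 fun i => hμ.ae_le ?_
    rw [mem_ae_iff]
    simpa [Set.compl_def] using volume_hyperplane i (x₀ i)
  filter_upwards [hne] with y hy
  have hcoord : ∀ i : Fin n, Continuous fun x : Rn n => x i := fun i => by fun_prop
  by_cases hx : x₀ ∈ orthant y
  · have hev : ∀ᶠ x in 𝓝 x₀, x ∈ orthant y := by
      refine (eventually_all.2 fun i => ?_ : ∀ᶠ x in 𝓝 x₀, ∀ i, x i ≤ y i)
      exact ((hcoord i).continuousAt.eventually_lt continuousAt_const
        ((hx i).lt_of_ne (hy i).symm)).mono fun _ h => le_of_lt h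
    refine continuousAt_const.congr (f := fun _ => g y) (hev.mono fun x hxy => ?_)
    exact (Set.indicator_of_mem (s := {y | x ∈ orthant y}) hxy g).symm
  · obtain ⟨i, hi⟩ : ∃ i, y i < x₀ i := by
      by_contra! hcon
      exact hx hcon
    have hev : ∀ᶠ x in 𝓝 x₀, y i < x i := continuousAt_const.eventually_lt
      (hcoord i).continuousAt hi
    refine continuousAt_const.congr (f := fun _ => (0 : ℂ)) (hev.mono fun x hxy => ?_)
    exact (Set.indicator_of_notMem (s := {y | x ∈ orthant y}) (fun h => (h i).not_gt hxy) g).symm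

/-- Write $f(y)$ as the integral of $\partial^{\mathbf 1}f$ over the orthant below $y$ and exchange
the integrals. No sign appears, because the boundary point sits in $f$ and the weight is integrated
over the opposite orthant. -/
lemma integral_mul_eq_integral_mul_der_one (μ : Measure (Rn n)) [SFinite μ] {g : Rn n → ℂ}
    (hg : Integrable g μ) (f : Smooth (⊤ : Opens (Rn n))) (hf : HasCompactSupport f) :
    ∫ y, g y * f y ∂μ = ∫ x, (∫ y in {y | x ∈ orthant y}, g y ∂μ) * der 1 f x := by
  have hD : Integrable (fun x => der 1 f x) :=
    (der 1 f).contDiff.continuous.integrable_of_hasCompactSupport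
      (hf.of_isClosed_subset (isClosed_tsupport _) (tsupport_der_subset 1 f))
  have hint : Integrable (Function.uncurry fun y x =>
      {p : Rn n × Rn n | p.2 ∈ orthant p.1}.indicator (fun p => g p.1 * der 1 f p.2) (y, x))
      (μ.prod volume) :=
    (hg.mul_prod hD).indicator isClosed_orthant_rel.measurableSet
  have hswap := integral_integral_swap hint
  refine Eq.trans ?_ (hswap.trans ?_)
  · refine integral_congr_ae (Eventually.of_forall fun y => ?_)
    have : ∀ x, {p : Rn n × Rn n | p.2 ∈ orthant p.1}.indicator
        (fun p => g p.1 * der 1 f p.2) (y, x) = (orthant y).indicator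
          (fun x => g y * der 1 f x) x := fun x => rfl
    simp only [this]
    rw [integral_indicator (measurableSet_orthant y), integral_const_mul,
      setIntegral_orthant_der_one f hf]
  · refine integral_congr_ae (Eventually.of_forall fun x => ?_)
    have : ∀ y, {p : Rn n × Rn n | p.2 ∈ orthant p.1}.indicator
        (fun p => g p.1 * der 1 f p.2) (y, x) = {y | x ∈ orthant y}.indicator
          (fun y => g y * der 1 f x) y := fun y => rfl
    simp only [this]
    rw [integral_indicator (measurableSet_setOf_mem_orthant x), integral_mul_const]

lemma memLp_of_hasCompactSupport (μ : Measure (Rn n)) [IsFiniteMeasure μ]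
    (f : Smooth (⊤ : Opens (Rn n))) (hf : HasCompactSupport f) : MemLp f 2 μ := by
  obtain ⟨C, hC⟩ := hf.exists_bound_of_continuous f.contDiff.continuous
  exact MemLp.of_bound f.contDiff.continuous.aestronglyMeasurable C (Eventually.of_forall hC)

/-- Extension by zero of test functions on `Ω`, as a linear map to the smooth functions. -/
noncomputable def extSmooth (Ω : Opens (Rn n)) : 𝓓(Ω, ℂ) →ₗ[ℂ] Smooth (⊤ : Opens (Rn n)) where
  toFun φ := ofTest (extTest le_top φ)
  map_add' _ _ := rfl
  map_smul' _ _ := rfl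

/-- A distribution of order `j` on a bounded open set is a derivative of a continuous function,
whose size is controlled by that of the distribution. -/
lemma exists_continuous_der_eq (hΩ : Bornology.IsBounded (Ω : Set (Rn n)))
    (K : CptIn (⊤ : Opens (Rn n))) (j : ℕ) :
    ∃ (α : Fin n → ℕ) (C : ℝ), 0 ≤ C ∧ ∀ (t : 𝓓(Ω, ℂ) →ₗ[ℂ] ℂ) (M : ℝ), 0 ≤ M →
      (∀ φ, ‖t φ‖ ≤ M * psemi ⊤ (K, j) (extSmooth Ω φ)) →
        ∃ f : C(Rn n, ℂ), (∀ x, ‖f x‖ ≤ C * M) ∧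
          ∀ φ, t φ = ∫ x, f x * der α (extSmooth Ω φ) x := by
  obtain ⟨R, hR, hΩR⟩ := hΩ.subset_closedBall_lt 0 0
  set J : Fin n → ℕ := fun _ => j
  set B := Metric.closedBall (0 : Rn n) R
  set μ := volume.restrict B
  have : IsFiniteMeasure μ := ⟨by
    rw [Measure.restrict_apply_univ]
    exact (isCompact_closedBall 0 R).measure_lt_top⟩
  set m := (μ Set.univ ^ (1 / 2 : ℝ)).toReal
  have hm : 0 ≤ m := ENNReal.toReal_nonneg
  have hcpt : ∀ (α : Fin n → ℕ) φ, HasCompactSupport (der α (extSmooth Ω φ)) := fun α φ =>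
    φ.hasCompactSupport.of_isClosed_subset (isClosed_tsupport _) (tsupport_der_subset _ _)
  have hsupp : ∀ φ, tsupport (extSmooth Ω φ) ⊆ B := fun φ => φ.tsupport_subset.trans hΩR
  -- The index $J$ dominates all derivatives of order at most $j$; the additional $\mathbf 1$ pays
  -- for passing from a supremum to an integral.
  let A : 𝓓(Ω, ℂ) →ₗ[ℂ] Lp ℂ 2 μ :=
    { toFun := fun φ => (memLp_of_hasCompactSupport μ _ (hcpt (1 + J) φ)).toLp _
      map_add' := fun φ ψ => by
        rw [← MemLp.toLp_add]
        refine MemLp.toLp_congr _ _ (Eventually.of_forall fun x => ?_)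
        rw [map_add, map_add]
        rfl
      map_smul' := fun c φ => by
        rw [RingHom.id_apply, ← MemLp.toLp_const_smul]
        refine MemLp.toLp_congr _ _ (Eventually.of_forall fun x => ?_)
        rw [map_smul, map_smul]
        rfl }
  have hA : ∀ φ, A φ =ᵐ[μ] der (1 + J) (extSmooth Ω φ) := fun φ =>
    MemLp.coeFn_toLp (memLp_of_hasCompactSupport μ _ (hcpt (1 + J) φ))
  -- The value at $y$ is an orthant integral of one more mixed derivative; all mass lies in $B$, and
  -- Cauchy–Schwarz there produces the factor $m$.
  have hbound : ∀ φ y, ‖der J (extSmooth Ω φ) y‖ ≤ m * ‖A φ‖ := by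
    intro φ y
    rw [← setIntegral_orthant_der_one _ (hcpt J φ), ← Module.End.mul_apply, ← der_add]
    have hint : Integrable fun x => ‖der (1 + J) (extSmooth Ω φ) x‖ :=
      ((der _ _).contDiff.continuous.integrable_of_hasCompactSupport (hcpt _ φ)).norm
    calc _ ≤ ∫ x in orthant y, ‖der (1 + J) (extSmooth Ω φ) x‖ := norm_integral_le_integral_norm _
      _ ≤ ∫ x, ‖der (1 + J) (extSmooth Ω φ) x‖ :=
        setIntegral_le_integral hint (Eventually.of_forall fun x => norm_nonneg _)
      _ = ∫ x in B, ‖der (1 + J) (extSmooth Ω φ) x‖ := by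
        refine (setIntegral_eq_integral_of_forall_compl_eq_zero fun x hx => ?_).symm
        rw [image_eq_zero_of_notMem_tsupport fun h => hx (hsupp φ (tsupport_der_subset _ _ h)),
          norm_zero]
      _ = ∫ x, ‖A φ x‖ ∂μ := integral_congr_ae ((hA φ).mono fun x hx => by simp only [hx])
      _ ≤ _ := integral_norm_le_mul_norm_Lp μ (A φ)
  -- The second $\mathbf 1$ turns the $L^2$ density into a continuous one. One factor $m$ comes from
  -- bounding $t$ by the $L^2$ norm, the other from bounding the continuous density by the norm of
  -- $g$.
  refine ⟨1 + (1 + J), m * ((2 * R + 1) ^ (n * j) * m), by positivity, fun t M hM ht => ?_⟩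
  obtain ⟨g, hgM, hg⟩ := exists_inner_eq_of_norm_le A t
    (M := M * ((2 * R + 1) ^ (n * j) * m)) (by positivity) fun φ => by
      refine (ht φ).trans ?_
      rw [mul_assoc, mul_assoc]
      exact mul_le_mul_of_nonneg_left
        (psemi_le_of_norm_der_le hR.le K j _ (hsupp φ) (hbound φ)) hM
  -- The inner product is conjugate-linear in its first argument, so the density is the conjugate of
  -- $g$; it is integrable because $\mu$ is finite.
  have hgint : Integrable (fun y => starRingEnd ℂ (g y)) μ := by
    have h1 : Integrable g μ := (Lp.memLp g).integrable (by norm_num)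
    exact (Complex.conjCLE.toContinuousLinearMap).integrable_comp h1
  refine ⟨⟨_, continuous_setIntegral_orthant Measure.absolutelyContinuous_restrict hgint⟩,
    fun x => ?_, fun φ => ?_⟩
  · calc _ ≤ ∫ y in {y | x ∈ orthant y}, ‖starRingEnd ℂ (g y)‖ ∂μ :=
          norm_integral_le_integral_norm _
      _ ≤ ∫ y, ‖starRingEnd ℂ (g y)‖ ∂μ :=
        setIntegral_le_integral hgint.norm (Eventually.of_forall fun x => norm_nonneg _)
      _ = ∫ y, ‖g y‖ ∂μ := by simp
      _ ≤ m * ‖g‖ := integral_norm_le_mul_norm_Lp μ g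
      _ ≤ m * (M * ((2 * R + 1) ^ (n * j) * m)) := mul_le_mul_of_nonneg_left hgM hm
      _ = _ := by ring
  · rw [hg, L2.inner_def, der_add, Module.End.mul_apply]
    refine Eq.trans ?_ (integral_mul_eq_integral_mul_der_one μ hgint _ (hcpt (1 + J) φ))
    refine integral_congr_ae ((hA φ).mono fun y hy => ?_)
    simp only [hy, RCLike.inner_apply]
    ring

end Structure

/-! ### The Leibniz rule with unspecified coefficients -/

section Leibniz

variable {n : ℕ} {Ω : Opens (Rn n)}

/-- `P` is a differential operator of order at most `m` with smooth coefficients. -/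
def IsDiffOp (m : ℕ) (P : Smooth Ω → Rn n → ℂ) : Prop :=
  ∃ a : (Fin n → ℕ) → Smooth Ω, ∀ f x, P f x = ∑ β ∈ multiIdx n m, a β x * der β f x

lemma IsDiffOp.add {m : ℕ} {P Q : Smooth Ω → Rn n → ℂ} (hP : IsDiffOp m P) (hQ : IsDiffOp m Q) :
    IsDiffOp m fun f x => P f x + Q f x := by
  obtain ⟨a, ha⟩ := hP
  obtain ⟨b, hb⟩ := hQ
  refine ⟨a + b, fun f x => ?_⟩
  refine (congrArg₂ (· + ·) (ha f x) (hb f x)).trans ?_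
  rw [← Finset.sum_add_distrib]
  exact Finset.sum_congr rfl fun β _ => (add_mul (a β x) (b β x) _).symm

lemma IsDiffOp.sum {m : ℕ} {ι : Type*} (s : Finset ι) {P : ι → Smooth Ω → Rn n → ℂ}
    (h : ∀ i ∈ s, IsDiffOp m (P i)) : IsDiffOp m fun f x => ∑ i ∈ s, P i f x := by
  classical
  induction s using Finset.induction_on with
  | empty =>
    refine ⟨0, fun f x => ?_⟩
    exact Finset.sum_empty.trans (Finset.sum_eq_zero fun β _ => zero_mul _).symm
  | insert i s hi ih =>
    simp only [Finset.sum_insert hi]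
    exact (h i (Finset.mem_insert_self i s)).add
      (ih fun k hk => h k (Finset.mem_insert_of_mem hk))

lemma isDiffOp_mul_der {m : ℕ} (χ : Smooth Ω) {β : Fin n → ℕ} (hβ : ∑ i, β i ≤ m) :
    IsDiffOp m fun (f : Smooth Ω) x => χ x * der β f x := by
  classical
  refine ⟨Pi.single β χ, fun f x => ?_⟩
  rw [Finset.sum_eq_single β]
  · rw [Pi.single_eq_same]
  · intro γ _ hγ
    rw [Pi.single_eq_of_ne hγ]
    exact zero_mul _
  · exact fun h => absurd (mem_multiIdx.2 hβ) h

/-- The Leibniz rule: `f ↦ ∂^α (χ f)` is a differential operator of order at most `|α|`. -/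
lemma isDiffOp_der_mul (α : Fin n → ℕ) :
    ∀ χ : Smooth Ω, IsDiffOp (∑ i, α i) fun f x => der α (χ.mul f) x := by
  induction α using multiIdx_induction with
  | h0 =>
    intro χ
    have := isDiffOp_mul_der (m := ∑ i, (0 : Fin n → ℕ) i) χ (β := 0) le_rfl
    rw [der_zero] at this ⊢
    exact this
  | h1 α i ih =>
    intro χ
    -- Since $\partial_i(\chi f)=(\partial_i\chi)f+\chi\,\partial_i f$, the hypothesis is needed for
    -- both $\partial_i\chi$ and $\chi$; this is why $\chi$ is quantified inside the induction.
    obtain ⟨a, ha⟩ := ih (pd i χ)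
    obtain ⟨b, hb⟩ := ih χ
    have hsum : ∑ k, (α + Pi.single i 1 : Fin n → ℕ) k = ∑ k, α k + 1 := by
      simp [Finset.sum_add_distrib]
    have h1 : IsDiffOp (∑ k, (α + Pi.single i 1 : Fin n → ℕ) k) fun (f : Smooth Ω) x =>
        ∑ β ∈ multiIdx n (∑ k, α k), a β x * der β f x := IsDiffOp.sum _ fun β hβ =>
      isDiffOp_mul_der _ (by rw [hsum]; exact (mem_multiIdx.1 hβ).trans (Nat.le_succ _))
    have h2 : IsDiffOp (∑ k, (α + Pi.single i 1 : Fin n → ℕ) k) fun (f : Smooth Ω) x =>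
        ∑ β ∈ multiIdx n (∑ k, α k), b β x * der (β + Pi.single i 1) f x :=
      IsDiffOp.sum _ fun β hβ => isDiffOp_mul_der _ (by
        rw [hsum]
        simpa [Finset.sum_add_distrib] using mem_multiIdx.1 hβ)
    convert h1.add h2 using 3 with f x
    rw [← ha, der_add_single, Module.End.mul_apply, pd_mul, map_add, Smooth.add_apply]
    refine congrArg₂ (· + ·) rfl ((hb (pd i f) x).trans ?_)
    simp only [der_add_single]
    rfl

end Leibniz

/-! ### From nets of distributions to nets of continuous functions -/

section Restriction

open MeasureTheory

variable {n : ℕ} {Ω : Opens (Rn n)}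

/-- The restriction of a continuous function to `Ω`. -/
noncomputable def restrictTo (Ω : Opens (Rn n)) (F : C(Rn n, ℂ)) : C(Ω, ℂ) :=
  F.comp ⟨Subtype.val, continuous_subtype_val⟩

lemma der_extSmooth (α : Fin n → ℕ) (φ : 𝓓(Ω, ℂ)) (x : Rn n) :
    der α (extSmooth Ω φ) x = der α (ofTest φ) x := by
  by_cases hx : x ∈ Ω
  · have : res le_top (extSmooth Ω φ) = ofTest φ := Smooth.ext fun y hy => res_apply _ _ hy
    rw [← this, der_res, res_apply _ _ hx]
  · rw [(der α (ofTest φ)).2.2 x hx]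
    exact image_eq_zero_of_notMem_tsupport fun h =>
      hx (φ.tsupport_subset (tsupport_der_subset α (extSmooth Ω φ) h))

lemma pairing_restrictTo (F : C(Rn n, ℂ)) (α : Fin n → ℕ) (φ : 𝓓(Ω, ℂ)) :
    pairing (restrictTo Ω F) (derTest α φ) = ∫ x, F x * der α (extSmooth Ω φ) x := by
  simp only [der_extSmooth]
  refine (integral_subtype_comap (μ := volume) Ω.isOpen.measurableSet
    fun x => F x * der α (ofTest φ) x).trans ?_
  refine setIntegral_eq_integral_of_forall_compl_eq_zero fun x hx => ?_
  rw [(der α (ofTest φ)).2.2 x hx, mul_zero]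

lemma isModerate_of_norm_le {f : Eps → C(Ω, ℂ)} {N : ℕ}
    (h : ∀ K : CptIn Ω, ∃ C : ℝ, 0 ≤ C ∧
      ∀ ε : Eps, ∀ x : Ω, x.1 ∈ K.1 → ‖f ε x‖ ≤ C * (ε : ℝ) ^ (-(N : ℝ))) :
    IsModerate (contSemi Ω) f := by
  intro K
  obtain ⟨C, hC0, hC⟩ := h ⟨Subtype.val '' (K : Set Ω), K.isCompact.image continuous_subtype_val,
    by rintro _ ⟨x, -, rfl⟩; exact x.2⟩
  refine ⟨N, IsBigO.of_bound C (Eventually.of_forall fun ε => ?_)⟩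
  have h0 : 0 ≤ (ε : ℝ) ^ (-(N : ℝ)) := Real.rpow_nonneg ε.2.1.le _
  rw [Real.norm_of_nonneg (apply_nonneg _ _), Real.norm_of_nonneg h0]
  exact contSemi_le _ _ (mul_nonneg hC0 h0) fun x hx => hC ε x ⟨x, hx, rfl⟩

/-- The derivative of a class is, by definition, the class of the differentiated net, so the
defining integral formula applies to `derNet α u`. -/
lemma dualDer_intFunCLM_represents (f : Eps → C(Ω, ℂ)) (hf : IsModerate (contSemi Ω) f)
    (α : Fin n → ℕ) (u : cptNets Ω) :
    Represents (dualDer α (onGc (intFunCLM f hf)) (cls u))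
      fun ε => (-1) ^ (∑ i, α i) * pairing (f ε) (derTest α (u.1 ε)) :=
  Represents.neg_one_pow_mul (isDefinedBy_intFunCLM f hf (derNet α u)) _

lemma neg_one_pow_mul_self (k : ℕ) : (-1 : ℂ) ^ k * (-1) ^ k = 1 := by
  rw [← mul_pow]
  simp

/-- A moderate net of distributions of fixed order is, on a bounded open set, a fixed derivative of
a moderate net of bounded continuous functions. -/
lemma exists_net_der_eq (hΩ : Bornology.IsBounded (Ω : Set (Rn n)))
    (K : CptIn (⊤ : Opens (Rn n))) (j N : ℕ) {c : ℝ} (hc : 0 < c) (η : Eps)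
    (t : Eps → 𝓓(Ω, ℂ) →ₗ[ℂ] ℂ)
    (ht : ∀ φ, ∀ ε ≤ η, ‖t ε φ‖ ≤ c * (ε : ℝ) ^ (-(N : ℝ)) * psemi ⊤ (K, j) (extSmooth Ω φ)) :
    ∃ (α : Fin n → ℕ) (F : Eps → C(Rn n, ℂ)) (D : ℝ), 0 ≤ D ∧
      (∀ ε x, ‖F ε x‖ ≤ D * (ε : ℝ) ^ (-(N : ℝ))) ∧
      ∀ φ, ∀ ε ≤ η, t ε φ = ∫ x, F ε x * der α (extSmooth Ω φ) x := by
  obtain ⟨α, C, hC, h⟩ := exists_continuous_der_eq hΩ K j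
  have hpos : ∀ ε : Eps, 0 ≤ (ε : ℝ) ^ (-(N : ℝ)) := fun ε => Real.rpow_nonneg ε.2.1.le _
  have hex : ∀ ε : Eps, ∃ f : C(Rn n, ℂ), (∀ x, ‖f x‖ ≤ C * c * (ε : ℝ) ^ (-(N : ℝ))) ∧
      (ε ≤ η → ∀ φ, t ε φ = ∫ x, f x * der α (extSmooth Ω φ) x) := by
    intro ε
    by_cases hε : ε ≤ η
    · obtain ⟨f, hf, hf'⟩ := h (t ε) _ (mul_nonneg hc.le (hpos ε)) fun φ => ht φ ε hε
      exact ⟨f, fun x => (hf x).trans_eq (mul_assoc _ _ _).symm, fun _ => hf'⟩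
    -- For $\varepsilon>\eta$ no estimate is available, and the value zero keeps the bound valid for
    -- all $\varepsilon$.
    · refine ⟨0, fun x => ?_, fun h => absurd h hε⟩
      simpa using mul_nonneg (mul_nonneg hC hc.le) (hpos ε)
  choose F hF hF' using hex
  exact ⟨α, F, C * c, by positivity, hF, fun φ ε hε => hF' ε hε φ⟩

/-- A basic functional on `𝒢_c(ℝ^n)` is, on a bounded open set, a derivative of a functional
defined by a net of continuous functions. -/
theorem exists_restrictFun_eq_dualDer {T : Gc (⊤ : Opens (Rn n)) →L[CTilde] CTilde}
    (hT : IsBasicGc T) (hΩ : Bornology.IsBounded (Ω : Set (Rn n))) :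
    ∃ (α : Fin n → ℕ) (F : GcOrd 0 Ω →L[CTilde] CTilde) (f : Eps → C(Ω, ℂ)),
      IsModerate (contSemi Ω) f ∧ IsDefinedBy (onGc F) f ∧
        restrictFun (le_top : Ω ≤ ⊤) T.toLinearMap = dualDer α (onGc F) := by
  obtain ⟨t, ht, hTt⟩ := hT
  -- Boundedness enters here: the closure is compact in $\mathbb R^n$, so a single order $j$ and
  -- exponent $N$ serve all test functions on $\Omega$.
  let K : CptIn (⊤ : Opens (Rn n)) := ⟨closure Ω, hΩ.isCompact_closure, fun _ _ => trivial⟩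
  obtain ⟨j, c, hc, N, η, hb⟩ := ht K
  let t' : Eps → 𝓓(Ω, ℂ) →ₗ[ℂ] ℂ := fun ε =>
    { toFun := fun φ => t ε (extTest le_top φ)
      map_add' := fun φ ψ => map_add (t ε) (extTest le_top φ) (extTest le_top ψ)
      map_smul' := fun z φ => map_smul (t ε) z (extTest le_top φ) }
  obtain ⟨α, F, D, hD, hF, hF'⟩ := exists_net_der_eq hΩ K j N hc η t' fun φ ε hε =>
    hb (extTest le_top φ) (φ.tsupport_subset.trans subset_closure) ε hε
  set k := ∑ i, α i with hk
  -- The sign built into $f$ cancels the one in the definition of the derivative of a functional.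
  let f : Eps → C(Ω, ℂ) := fun ε => restrictTo Ω (((-1 : ℂ) ^ k) • F ε)
  have hf : IsModerate (contSemi Ω) f := isModerate_of_norm_le (N := N) fun _ =>
    ⟨D, hD, fun ε x _ => by simpa [f, restrictTo] using hF ε x⟩
  refine ⟨α, intFunCLM f hf, f, hf, isDefinedBy_intFunCLM f hf, LinearMap.ext fun w => ?_⟩
  obtain ⟨u, rfl⟩ := cls_surjective w
  have h1 := hTt (extNet le_top u)
  rw [← extGc_cls] at h1
  refine h1.eq (dualDer_intFunCLM_represents f hf α u) (isNegligible_of_eventually_eq (η := η)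
    fun ε hε => ?_)
  refine (hF' (u.1 ε) ε hε).trans ?_
  rw [pairing_restrictTo, ← integral_const_mul]
  refine integral_congr_ae (Eventually.of_forall fun x => ?_)
  simp only [ContinuousMap.smul_apply, smul_eq_mul, ← mul_assoc, ← hk, neg_one_pow_mul_self,
    one_mul]

/-- The cutoff has to be 1 on an open neighbourhood of $K$, not merely on $K$, because the seminorms
on $K$ also see derivatives. -/
lemma exists_cutoff (K : CptIn (⊤ : Opens (Rn n))) :
    ∃ (V W : Opens (Rn n)) (χ : Smooth (⊤ : Opens (Rn n))), Bornology.IsBounded (V : Set (Rn n)) ∧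
      tsupport χ ⊆ V ∧ HasCompactSupport χ ∧ K.1 ⊆ W ∧ ∀ x ∈ W, χ x = 1 := by
  obtain ⟨R, hR, hK⟩ := K.2.1.isBounded.subset_ball_lt 0 0
  let b : ContDiffBump (0 : Rn n) := ⟨R, R + 1, hR, lt_add_one R⟩
  have hb : ContDiff ℝ ∞ fun x => (b x : ℂ) := Complex.ofRealCLM.contDiff.comp b.contDiff
  have hsupp : tsupport (fun x => (b x : ℂ)) ⊆ Metric.closedBall 0 (R + 1) := by
    refine closure_minimal (fun x hx => ?_) Metric.isClosed_closedBall
    rw [← show b.rOut = R + 1 from rfl, ← b.tsupport_eq]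
    exact subset_tsupport _ fun h => hx (by simp [h])
  refine ⟨⟨Metric.ball 0 (R + 2), Metric.isOpen_ball⟩, ⟨Metric.ball 0 R, Metric.isOpen_ball⟩,
    ⟨fun x => (b x : ℂ), hb.contDiffOn, fun x hx => absurd trivial hx⟩, Metric.isBounded_ball,
    hsupp.trans (Metric.closedBall_subset_ball (by linarith)),
    (isCompact_closedBall _ _).of_isClosed_subset (isClosed_tsupport _) hsupp, hK, fun x hx => ?_⟩
  change (b x : ℂ) = 1
  rw [b.one_of_mem_closedBall (Metric.ball_subset_closedBall hx), Complex.ofReal_one]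

/-- A basic functional on `𝒢(ℝ^n)` is a finite sum of derivatives of functionals defined by nets
of continuous functions. -/
theorem exists_comp_incl_eq_sum_dualDer {T : G (⊤ : Opens (Rn n)) →L[CTilde] CTilde}
    (hT : IsBasicG T) :
    ∃ (m : ℕ) (F : (Fin n → ℕ) → GcOrd 0 (⊤ : Opens (Rn n)) →L[CTilde] CTilde),
      (∀ α : Fin n → ℕ, ∑ i, α i ≤ m → ∃ f : Eps → C((⊤ : Opens (Rn n)), ℂ),
        IsModerate (contSemi ⊤) f ∧ IsDefinedBy (onGc (F α)) f) ∧
      T.toLinearMap ∘ₗ Gc.incl = ∑ α ∈ multiIdx n m, dualDer α (onGc (F α)) := by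
  obtain ⟨t, ⟨K, j, c, hc, N, η, hb⟩, hTt⟩ := hT
  obtain ⟨V, W, χ, hV, hχV, hχc, hKW, hχW⟩ := exists_cutoff K
  obtain ⟨α, F, D, hD, hF, hF'⟩ := exists_net_der_eq hV K j N hc η
    (fun ε => (t ε).toLinearMap ∘ₗ extSmooth V) fun φ ε hε => hb (extSmooth V φ) ε hε
  obtain ⟨a, ha⟩ := isDiffOp_der_mul α χ
  let A : (Fin n → ℕ) → C(Rn n, ℂ) := fun β => ⟨a β, (a β).contDiff.continuous⟩
  -- By the Leibniz rule the coefficient $a_\beta$ multiplies the single density $F_\varepsilon$;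
  -- the sign is the one absorbed by $\partial^\beta$ on functionals.
  let f : (Fin n → ℕ) → Eps → C((⊤ : Opens (Rn n)), ℂ) := fun β ε =>
    restrictTo ⊤ (((-1 : ℂ) ^ (∑ i, β i)) • (F ε * A β))
  have hf : ∀ β, IsModerate (contSemi ⊤) (f β) := fun β =>
    isModerate_of_norm_le (N := N) fun L => by
      obtain ⟨C, hC⟩ := L.2.1.exists_bound_of_continuousOn (A β).continuous.continuousOn
      -- The maximum with 0 covers an empty compact set, for which the bound $C$ may be negative.
      refine ⟨D * max C 0, by positivity, fun ε x hx => ?_⟩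
      have h1 : ‖f β ε x‖ = ‖F ε x‖ * ‖A β x‖ := by simp [f, restrictTo]
      rw [h1]
      calc _ ≤ (D * (ε : ℝ) ^ (-(N : ℝ))) * max C 0 :=
            mul_le_mul (hF ε x) ((hC x hx).trans (le_max_left _ _)) (norm_nonneg _)
              (mul_nonneg hD (Real.rpow_nonneg ε.2.1.le _))
        _ = _ := by ring
  refine ⟨∑ i, α i, fun β => intFunCLM (f β) (hf β), fun β _ =>
    ⟨f β, hf β, isDefinedBy_intFunCLM _ _⟩, LinearMap.ext fun w => ?_⟩
  obtain ⟨u, rfl⟩ := cls_surjective w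
  rw [LinearMap.sum_apply]
  refine Represents.eq (hTt _ u.2.2) (Represents.sum _ fun β =>
    dualDer_intFunCLM_represents (f β) (hf β) β u) (isNegligible_of_eventually_eq (η := η)
    fun ε hε => ?_)
  set φ := u.1 ε
  -- The difference $\varphi-\chi\varphi$ vanishes near $K$, so the seminorm that bounds
  -- $t_\varepsilon$ is zero on it.
  have hcut : t ε (ofTest φ) = t ε (χ.mul (ofTest φ)) := by
    rw [← sub_eq_zero, ← map_sub, ← norm_le_zero_iff]
    refine (hb _ ε hε).trans_eq ?_
    have h0 : psemi ⊤ (K, j) (ofTest φ - χ.mul (ofTest φ)) = 0 := by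
      refine le_antisymm ((psemi_le_iff _ _ _ le_rfl).2 fun β _ x hx => ?_) (apply_nonneg _ _)
      rw [der_eq_zero_of_eventuallyEq (Opens.mem_top x), norm_zero]
      refine (W.isOpen.eventually_mem (hKW hx)).mono fun y hy => ?_
      change φ y - χ y * φ y = 0
      rw [hχW y hy, one_mul, sub_self]
    rw [h0, mul_zero]
  have hsub : tsupport (χ.mul (ofTest φ)) ⊆ tsupport χ :=
    closure_mono fun x hx h => hx (by change χ x * φ x = 0; rw [h, zero_mul])
  -- The product $\chi\varphi$ is a test function on the bounded set $V$, to which the local theorem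
  -- applies although the supports of $u$ may leave $V$.
  let ψ : 𝓓(V, ℂ) := ⟨χ.mul (ofTest φ), (χ.mul (ofTest φ)).contDiff,
    hχc.of_isClosed_subset (isClosed_tsupport _) hsub, hsub.trans hχV⟩
  have hψ : extSmooth V ψ = χ.mul (ofTest φ) := rfl
  have h1 := hF' ψ ε hε
  simp only [LinearMap.comp_apply, hψ, ha] at h1
  refine hcut.trans (h1.trans ?_)
  simp only [Finset.mul_sum]
  have hint : ∀ β, Integrable fun x => F ε x * (a β x * der β (ofTest φ) x) := fun β => by
    refine Continuous.integrable_of_hasCompactSupport ((F ε).continuous.mul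
      ((a β).contDiff.continuous.mul (der β (ofTest φ)).contDiff.continuous)) ?_
    exact ((derTest β φ).hasCompactSupport.mul_left (f := fun x => a β x)).mul_left
  rw [integral_finsetSum _ fun β _ => hint β]
  refine Finset.sum_congr rfl fun β _ => ?_
  rw [pairing_restrictTo, ← integral_const_mul]
  refine integral_congr_ae (Eventually.of_forall fun x => ?_)
  simp only [ContinuousMap.smul_apply, ContinuousMap.mul_apply, smul_eq_mul, ← mul_assoc,
    neg_one_pow_mul_self, one_mul]
  rfl

end Restriction

end Colombeau

theorem mainTheorem8 (n : ℕ) :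
    (∀ T : Gc (⊤ : Opens (Rn n)) →L[CTilde] CTilde, IsBasicGc T →
      ∀ Ω : Opens (Rn n), Bornology.IsBounded (Ω : Set (Rn n)) →
        ∃ (α : Fin n → ℕ) (F : GcOrd 0 Ω →L[CTilde] CTilde) (f : Eps → C(Ω, ℂ)),
          IsModerate (contSemi Ω) f ∧ IsDefinedBy (onGc F) f ∧
            restrictFun (le_top : Ω ≤ ⊤) T.toLinearMap = dualDer α (onGc F)) ∧
    (∀ T : G (⊤ : Opens (Rn n)) →L[CTilde] CTilde, IsBasicG T →
      ∃ (m : ℕ) (F : (Fin n → ℕ) → GcOrd 0 (⊤ : Opens (Rn n)) →L[CTilde] CTilde),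
        (∀ α : Fin n → ℕ, ∑ i, α i ≤ m → ∃ f : Eps → C((⊤ : Opens (Rn n)), ℂ),
          IsModerate (contSemi ⊤) f ∧ IsDefinedBy (onGc (F α)) f) ∧
        T.toLinearMap ∘ₗ Gc.incl = ∑ α ∈ multiIdx n m, dualDer α (onGc (F α))) :=
  ⟨fun _ hT _ hΩ => exists_restrictFun_eq_dualDer hT hΩ,
    fun _ hT => exists_comp_incl_eq_sum_dualDer hT⟩
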